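/- Let $1\le n\le m$ be integers, let $\Omega\subset\mathbb{R}^n$ be a domain, and let $\omega=\sum_I\phi_I\,dx_I$ (sum over $I=(i_1<\dots<i_n)$, $1\le i_k\le m$) be a smooth, closed, nowhere vanishing differential $n$-form on $\mathbb{R}^m$ which is bounded, that is, every $\phi_I$ is a bounded function and there is $c>0$ such that for every $p\in\mathbb{R}^m$ there is $I$ with $|\phi_I(p)|>c$. Let $\|\omega\|(p)=\sup\{|\omega_p(v_1,\dots,v_n)| : v_i\in\mathbb{R}^m,\ |v_i|\le 1\}$ be the comass norm. Let $f=(f_1,\dots,f_m)\in W^{1,1}_{loc}(\Omega,\mathbb{R}^m)$ be a finite distortion $\omega$-curve: writing $f^*\omega=(\star f^*\omega)\,dx_1\wedge\dots\wedge dx_n$ for the pullback defined through the weak differential $Df$, we have $\star f^*\omega\in L^1_{loc}(\Omega)$, and there is a measurable function $K_f\ge 1$ on $\Omega$, finite almost everywhere, such that $$(\|\omega\|\circ f)\,|Df|^n\le K_f\,(\star f^*\omega)\quad\text{almost everywhere on }\Omega,$$ where $|Df|$ is the operator norm. Suppose that $\exp(\lambda K_f)\in L^1_{loc}(\Omega)$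 for some $\lambda>0$, and that every coordinate function $u=f_i$, $i=1,\dots,m$, is weakly monotone: for every ball $B$ compactly contained in $\Omega$ and all reals $a\le b$ such that $|b-u|-|u-a|+2u-a-b\in W^{1,1}_0(B)$, we have $a\le u(x)\le b$ for almost every $x\in B$; here $W^{1,1}_0(B)$ is the closure of $C_c^\infty(B)$ in the Sobolev space $W^{1,1}(B)$. Then $f$ has a continuous representative in $\Omega$, that is, there is a continuous map $g\colon\Omega\to\mathbb{R}^m$ with $g=f$ almost everywhere on $\Omega$. -/

import Mathlib

open MeasureTheory Metric Set Filter Topology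
open scoped ENNReal

noncomputable section

/-- `φ ∈ C_c^∞(U)`: smooth functions with compact support contained in `U`. -/
structure IsTestFunction {n : ℕ} (U : Set (EuclideanSpace ℝ (Fin n)))
    (φ : EuclideanSpace ℝ (Fin n) → ℝ) : Prop where
  smooth : ContDiff ℝ (⊤ : ℕ∞) φ
  compact : HasCompactSupport φ
  support_subset : tsupport φ ⊆ U

/-- `f ∈ W^{1,1}_loc(U, F)` and its weak differential is `Df`. -/
structure HasWeakFDeriv {n : ℕ} {F : Type*} [NormedAddCommGroup F] [NormedSpace ℝ F]
    (U : Set (EuclideanSpace ℝ (Fin n))) (f : EuclideanSpace ℝ (Fin n) → F)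
    (Df : EuclideanSpace ℝ (Fin n) → EuclideanSpace ℝ (Fin n) →L[ℝ] F) : Prop where
  locallyIntegrable : LocallyIntegrableOn f U
  locallyIntegrable_deriv : LocallyIntegrableOn Df U
  integral_eq : ∀ φ : EuclideanSpace ℝ (Fin n) → ℝ, IsTestFunction U φ →
    ∀ v : EuclideanSpace ℝ (Fin n),
      ∫ x in U, (fderiv ℝ φ x v) • f x = - ∫ x in U, φ x • Df x v

/-- The real-valued Sobolev space `W^{1,1}_loc(U)`. -/
def MemW11Loc {n : ℕ} (U : Set (EuclideanSpace ℝ (Fin n)))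
    (u : EuclideanSpace ℝ (Fin n) → ℝ) : Prop :=
  ∃ Du, HasWeakFDeriv U u Du

/-- `W^{1,1}_0(U)`: the functions of `W^{1,1}(U)` that lie in the closure of `C_c^∞(U)` for the
norm `∫_U |u| + ∫_U |Du|`. -/
def MemW11Zero {n : ℕ} (U : Set (EuclideanSpace ℝ (Fin n)))
    (u : EuclideanSpace ℝ (Fin n) → ℝ) : Prop :=
  ∃ Du, HasWeakFDeriv U u Du ∧ IntegrableOn u U ∧ IntegrableOn Du U ∧
    ∀ ε : ℝ, 0 < ε → ∃ φ, IsTestFunction U φ ∧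
      (∫ x in U, |u x - φ x|) + (∫ x in U, ‖Du x - fderiv ℝ φ x‖) < ε

/-- Weakly monotone functions on an open set `Ω`. -/
def WeaklyMonotone {n : ℕ} (Ω : Set (EuclideanSpace ℝ (Fin n)))
    (u : EuclideanSpace ℝ (Fin n) → ℝ) : Prop :=
  MemW11Loc Ω u ∧
    ∀ (z : EuclideanSpace ℝ (Fin n)) (r : ℝ), 0 < r → closedBall z r ⊆ Ω →
      ∀ a b : ℝ, a ≤ b →
        MemW11Zero (ball z r) (fun x => |b - u x| - |u x - a| + 2 * u x - a - b) →
        ∀ᵐ x ∂(volume.restrict (ball z r)), a ≤ u x ∧ u x ≤ b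

/-- An `n`-volume form on `ℝ^m`: a smooth, closed, nowhere vanishing differential `n`-form. -/
structure IsVolumeForm {n m : ℕ}
    (ω : EuclideanSpace ℝ (Fin m) → EuclideanSpace ℝ (Fin m) [⋀^Fin n]→L[ℝ] ℝ) : Prop where
  smooth : ContDiff ℝ (⊤ : ℕ∞) ω
  closed : ∀ p, extDeriv ω p = 0
  ne_zero : ∀ p, ω p ≠ 0

/-- The coefficient `φ_I` in `ω = ∑_I φ_I dx_I`, for `I = (i_1 < ⋯ < i_n)`. -/
def formCoeff {n m : ℕ}
    (ω : EuclideanSpace ℝ (Fin m) → EuclideanSpace ℝ (Fin m) [⋀^Fin n]→L[ℝ] ℝ)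
    (I : Fin n ↪o Fin m) (p : EuclideanSpace ℝ (Fin m)) : ℝ :=
  ω p (fun k => EuclideanSpace.single (I k) (1 : ℝ))

/-- Bounded forms: all coefficients are bounded, and at every point some coefficient is larger in
absolute value than a fixed positive constant. -/
structure IsBoundedForm {n m : ℕ}
    (ω : EuclideanSpace ℝ (Fin m) → EuclideanSpace ℝ (Fin m) [⋀^Fin n]→L[ℝ] ℝ) : Prop where
  bounded : ∀ I : Fin n ↪o Fin m, ∃ C : ℝ, ∀ p, |formCoeff ω I p| ≤ C
  bounded_below : ∃ c : ℝ, 0 < c ∧ ∀ p, ∃ I : Fin n ↪o Fin m, c < |formCoeff ω I p|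

/-- The comass norm of an `n`-covector. -/
def comass {n m : ℕ} (α : EuclideanSpace ℝ (Fin m) [⋀^Fin n]→L[ℝ] ℝ) : ℝ :=
  sSup {t : ℝ | ∃ v : Fin n → EuclideanSpace ℝ (Fin m), (∀ i, ‖v i‖ ≤ 1) ∧ t = |α v|}

/-- `⋆ f^*ω`, where `Df` is the weak differential of `f`: the value of the pulled back form
`f^*ω` on the standard basis, that is, its coefficient with respect to `dx_1 ∧ ⋯ ∧ dx_n`. -/
def starPullback {n m : ℕ}
    (ω : EuclideanSpace ℝ (Fin m) → EuclideanSpace ℝ (Fin m) [⋀^Fin n]→L[ℝ] ℝ)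
    (f : EuclideanSpace ℝ (Fin n) → EuclideanSpace ℝ (Fin m))
    (Df : EuclideanSpace ℝ (Fin n) → EuclideanSpace ℝ (Fin n) →L[ℝ] EuclideanSpace ℝ (Fin m))
    (x : EuclideanSpace ℝ (Fin n)) : ℝ :=
  ((ω (f x)).compContinuousLinearMap (Df x)) (fun i => EuclideanSpace.single i (1 : ℝ))

/-- `f` is a finite distortion `ω`-curve on `Ω` with distortion function `K`. The function `K` may
take the value `∞` on a null set. The weak differential `Df` is unique up to null sets. -/
def IsFiniteDistortionCurve {n m : ℕ} (Ω : Set (EuclideanSpace ℝ (Fin n)))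
    (ω : EuclideanSpace ℝ (Fin m) → EuclideanSpace ℝ (Fin m) [⋀^Fin n]→L[ℝ] ℝ)
    (f : EuclideanSpace ℝ (Fin n) → EuclideanSpace ℝ (Fin m))
    (K : EuclideanSpace ℝ (Fin n) → ℝ≥0∞) : Prop :=
  ∃ Df : EuclideanSpace ℝ (Fin n) → EuclideanSpace ℝ (Fin n) →L[ℝ] EuclideanSpace ℝ (Fin m),
    HasWeakFDeriv Ω f Df ∧
    LocallyIntegrableOn (starPullback ω f Df) Ω ∧
    AEMeasurable K (volume.restrict Ω) ∧
    (∀ x ∈ Ω, 1 ≤ K x) ∧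
    (∀ᵐ x ∂(volume.restrict Ω), K x < ∞) ∧
    ∀ᵐ x ∂(volume.restrict Ω),
      comass (ω (f x)) * ‖Df x‖ ^ n ≤ (K x).toReal * starPullback ω f Df x

end

/-! The comass of a bounded form is bounded below by some c > 0, so the distortion inequality reads
c |Df|^n ≤ K J with J = ⋆f^*ω locally integrable. Exponential integrability of K falls just short of
|Df| ∈ L^n, but it gives ε ∫ |Df|^(n-ε) → 0 on balls as ε ↓ 0 (`tendsto_mul_lintegral_rpow_zero`): a
Young type inequality bounds ε |Df|^(n-ε) by a fixed integrable combination of 1, exp(λK) and J, and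
dominated convergence applies. Every coordinate u of f inherits this.

Let n ≥ 2. On (n-1)-dimensional spheres an exponent p = n - ε > n - 1 is supercritical, and Morrey's
inequality bounds (osc of u on S_t)^p by C t^p times the integral over θ of |Du(z + tθ)|^p, with C
uniform for p in [n - 1/2, n]. If the oscillation exceeded η on almost every sphere of radius t < R,
integration in polar coordinates would give ∫ |Du|^p ≥ (η^n / C) ∫_0^R t^(n-1-p) dt = (η^n / C) R^ε
/ ε, which contradicts ε ∫ |Du|^(n-ε) → 0. So arbitrarily small spheres carry small oscillation.
Traces are avoided by working with mollifications w_k: Fatou's lemma gives one radius that is good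
for infinitely many k (`exists_radius_frequently_osc_le`).

On such a sphere the values of w_k lie strictly between two close levels a < b. Smooth truncations
of w_k at these levels vanish near the sphere, so the truncation of u lies in W^{1,1}_0 of the ball
(`memW11Zero_truncation`), and weak monotonicity forces a ≤ u ≤ b almost everywhere inside. Hence
the essential oscillation of u vanishes at each point, which yields a continuous representative. For
n = 1 absolute continuity of ∫ |Du| suffices. -/

/-- A function whose essential oscillation at every point of an open set `Ω` vanishes agrees almost
everywhere on `Ω` with a function that is continuous on `Ω`. -/
theorem exists_continuousOn_ae_eq_of_essOsc {n : ℕ} {F : Type*} [NormedAddCommGroup F]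
    [CompleteSpace F] {Ω : Set (EuclideanSpace ℝ (Fin n))} (hΩ : IsOpen Ω)
    (f : EuclideanSpace ℝ (Fin n) → F)
    (h : ∀ z ∈ Ω, ∀ δ : ℝ, 0 < δ → ∃ t : ℝ, 0 < t ∧ ∃ c : F,
      ∀ᵐ x ∂(volume.restrict (ball z t)), ‖f x - c‖ ≤ δ) :
    ∃ g : EuclideanSpace ℝ (Fin n) → F, ContinuousOn g Ω ∧ g =ᵐ[volume.restrict Ω] f := by
  have hδ : ∀ k : ℕ, (0 : ℝ) < 1 / (k + 1) := fun k => Nat.one_div_pos_of_nat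
  choose! t ht c hc using fun (k : ℕ) (z : EuclideanSpace ℝ (Fin n)) (hz : z ∈ Ω) =>
    h z hz _ (hδ k)
  have hcov : ∀ k, ∃ S ⊆ Ω, S.Countable ∧ Ω ⊆ ⋃ z ∈ S, ball z (t k z) := fun k =>
    TopologicalSpace.countable_cover_nhdsWithin fun z hz =>
      mem_nhdsWithin_of_mem_nhds (ball_mem_nhds z (ht k z hz))
  choose S hSΩ hSc hS using hcov
  -- Countably many balls suffice for each `k`, so all the oscillation bounds hold at once off a
  -- null set. The remaining set is dense, and `f` restricted to it satisfies the Cauchy condition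
  -- at each point of `Ω`; its limits define `g`.
  have hG : ∀ᵐ x : EuclideanSpace ℝ (Fin n), ∀ k, ∀ z ∈ S k, x ∈ ball z (t k z) →
      ‖f x - c k z‖ ≤ 1 / (k + 1) := by
    refine ae_all_iff.2 fun k => (ae_ball_iff (hSc k)).2 fun z hz => ?_
    exact (ae_restrict_iff' measurableSet_ball).1 (hc k z (hSΩ k hz))
  set G := {x : EuclideanSpace ℝ (Fin n) | ∀ k, ∀ z ∈ S k, x ∈ ball z (t k z) →
      ‖f x - c k z‖ ≤ 1 / (k + 1)} with hGdef
  have hdense : Dense G := Measure.dense_of_ae hG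
  have hcl : Ω ⊆ closure (Ω ∩ G) := hdense.open_subset_closure_inter hΩ
  have hlim : ∀ x ∈ Ω, ∃ y, Tendsto f (𝓝[Ω ∩ G] x) (𝓝 y) := by
    intro x hx
    have : NeBot (𝓝[Ω ∩ G] x) := mem_closure_iff_nhdsWithin_neBot.1 (hcl hx)
    refine cauchy_map_iff_exists_tendsto.1 (Metric.cauchy_iff.2 ⟨inferInstance, fun ε hε => ?_⟩)
    obtain ⟨k, hk⟩ := exists_nat_one_div_lt (half_pos hε)
    obtain ⟨z, hz, hxz⟩ := mem_iUnion₂.1 (hS k hx)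
    refine ⟨f '' (ball z (t k z) ∩ (Ω ∩ G)), image_mem_map ?_, ?_⟩
    · exact inter_mem (mem_nhdsWithin_of_mem_nhds (isOpen_ball.mem_nhds hxz)) self_mem_nhdsWithin
    · rintro _ ⟨a, ⟨ha, -, haG⟩, rfl⟩ _ ⟨b, ⟨hb, -, hbG⟩, rfl⟩
      have h1 := haG k z hz ha
      have h2 := hbG k z hz hb
      rw [← dist_eq_norm] at h1 h2
      linarith [dist_triangle_right (f a) (f b) (c k z)]
  refine ⟨extendFrom (Ω ∩ G) f, continuousOn_extendFrom hcl hlim, ?_⟩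
  filter_upwards [ae_restrict_mem hΩ.measurableSet, ae_restrict_of_ae hG] with x hx hxG
  obtain ⟨y, hy⟩ := hlim x hx
  have : f x = y := tendsto_nhds_unique (tendsto_pure_nhds f x)
    (hy.mono_left (pure_le_nhdsWithin ⟨hx, hxG⟩))
  rw [extendFrom_eq (hcl hx) hy, this]

/-! ### Energy of order n - ε from exponentially integrable distortion -/

/-- The comass dominates every coefficient of a covector. -/
theorem abs_formCoeff_le_comass {n m : ℕ}
    (ω : EuclideanSpace ℝ (Fin m) → EuclideanSpace ℝ (Fin m) [⋀^Fin n]→L[ℝ] ℝ)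
    (I : Fin n ↪o Fin m) (p : EuclideanSpace ℝ (Fin m)) :
    |formCoeff ω I p| ≤ comass (ω p) := by
  refine le_csSup ⟨‖ω p‖, ?_⟩ ⟨_, fun i => by simp, rfl⟩
  rintro _ ⟨v, hv, rfl⟩
  refine ((ω p).le_opNorm v).trans ?_
  exact mul_le_of_le_one_right (norm_nonneg _)
    (Finset.prod_le_one (fun i _ => norm_nonneg _) fun i _ => hv i)

/-- The Young type inequality behind the integrability of `‖Df‖ ^ (n - ε)` for exponentially
integrable distortion. -/
theorem mul_rpow_one_sub_le {lam κ j θ : ℝ} (hlam : 0 < lam) (hκ : 1 ≤ κ) (hj : 0 ≤ j)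
    (hθ : 0 < θ) (hθ1 : θ < 1) :
    θ * (κ * j) ^ (1 - θ) ≤ 1 + 2 / lam * Real.exp (lam * κ) + 2 / lam * j := by
  have hκ0 : 0 < κ := by linarith
  have hl : 0 < 2 / lam := by positivity
  -- Below the threshold exp(λκ/2) the product κj is controlled by exp(λκ). Above it, κ ≤ (2/λ) log
  -- j, and the factor θ absorbs the logarithm because θ log j = log (j^θ) ≤ j^θ.
  rcases le_or_gt j (Real.exp (lam * κ / 2)) with hle | hgt
  · have h1 : κ ≤ 2 / lam * Real.exp (lam * κ / 2) := by
      have := Real.add_one_le_exp (lam * κ / 2)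
      rw [div_mul_eq_mul_div, le_div_iff₀ hlam]
      linarith
    have h2 : κ * j ≤ 2 / lam * Real.exp (lam * κ) := by
      calc κ * j ≤ (2 / lam * Real.exp (lam * κ / 2)) * Real.exp (lam * κ / 2) := by gcongr
        _ = 2 / lam * Real.exp (lam * κ) := by
          rw [mul_assoc, ← Real.exp_add]; ring_nf
    have h3 : (κ * j) ^ (1 - θ) ≤ 1 + κ * j := by
      rcases le_total (κ * j) 1 with h | h
      · have := Real.rpow_le_one (by positivity : 0 ≤ κ * j) h (by linarith : 0 ≤ 1 - θ)
        have : 0 ≤ κ * j := by positivity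
        linarith
      · have := Real.rpow_le_rpow_of_exponent_le h (by linarith : 1 - θ ≤ 1)
        rw [Real.rpow_one] at this
        linarith
    have h4 : 0 ≤ (κ * j) ^ (1 - θ) := by positivity
    have h5 : 0 ≤ 2 / lam * j := by positivity
    nlinarith
  · have hj1 : 0 < j := (Real.exp_pos _).trans hgt
    have h1 : κ ≤ 2 / lam * Real.log j := by
      have := (Real.lt_log_iff_exp_lt hj1).2 hgt
      rw [div_mul_eq_mul_div, le_div_iff₀ hlam]
      linarith
    have h2 : θ * Real.log j ≤ j ^ θ := by
      rw [← Real.log_rpow hj1]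
      exact Real.log_le_self (by positivity)
    have h3 : κ ^ (1 - θ) ≤ κ := by
      simpa using Real.rpow_le_rpow_of_exponent_le hκ (by linarith : 1 - θ ≤ 1)
    have h4 : θ * (κ * j) ^ (1 - θ) ≤ 2 / lam * j := by
      calc θ * (κ * j) ^ (1 - θ) = θ * (κ ^ (1 - θ) * j ^ (1 - θ)) := by
            rw [Real.mul_rpow hκ0.le hj]
        _ ≤ θ * ((2 / lam * Real.log j) * j ^ (1 - θ)) := by
            gcongr; exact h3.trans h1
        _ = 2 / lam * ((θ * Real.log j) * j ^ (1 - θ)) := by ring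
        _ ≤ 2 / lam * (j ^ θ * j ^ (1 - θ)) := by gcongr
        _ = 2 / lam * j := by rw [← Real.rpow_add hj1]; simp
    have : 0 ≤ 2 / lam * Real.exp (lam * κ) := by positivity
    linarith

/-- Exponential integrability of the distortion gives `ε ∫ ‖g‖ ^ (n - ε) → 0` as `ε ↓ 0`. -/
theorem tendsto_mul_lintegral_rpow_zero {α G : Type*} [MeasurableSpace α] {μ : Measure α}
    [IsFiniteMeasure μ] [NormedAddCommGroup G] {n : ℕ} (hn : 1 ≤ n) {g : α → G}
    (hg : AEStronglyMeasurable g μ) {κ j : α → ℝ} {c lam : ℝ} (hc : 0 < c) (hlam : 0 < lam)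
    (hκ : ∀ᵐ x ∂μ, 1 ≤ κ x) (hj : Integrable j μ)
    (hexp : Integrable (fun x => Real.exp (lam * κ x)) μ)
    (hle : ∀ᵐ x ∂μ, c * ‖g x‖ ^ n ≤ κ x * j x) :
    Tendsto (fun ε : ℝ => ∫⁻ x, ENNReal.ofReal (ε * ‖g x‖ ^ ((n : ℝ) - ε)) ∂μ)
      (𝓝[>] 0) (𝓝 0) := by
  wlog hgm : StronglyMeasurable g generalizing g
  · have h := this hg.stronglyMeasurable_mk.aestronglyMeasurable (by
      filter_upwards [hle, hg.ae_eq_mk] with x hx hx'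
      rwa [← hx']) hg.stronglyMeasurable_mk
    refine h.congr fun ε => lintegral_congr_ae ?_
    filter_upwards [hg.ae_eq_mk] with x hx
    rw [hx]
  have hn0 : (0 : ℝ) < n := by exact_mod_cast hn
  have hn1 : (1 : ℝ) ≤ n := by exact_mod_cast hn
  -- The Young type inequality is used with θ = ε/n and j/c in place of j, since n - ε = n(1 - θ);
  -- writing ε = nθ produces the leading factor n.
  set bound : α → ℝ := fun x => n * (1 + 2 / lam * Real.exp (lam * κ x) + 2 / lam * (j x / c))
  have hbint : Integrable bound μ :=
    (((integrable_const _).add (hexp.const_mul _)).add ((hj.div_const c).const_mul _)).const_mul _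
  have hlt : ∀ᶠ ε : ℝ in 𝓝[>] 0, 0 < ε ∧ ε < 1 :=
    Ioo_mem_nhdsGT (zero_lt_one' ℝ)
  have key := tendsto_lintegral_filter_of_dominated_convergence (μ := μ) (l := 𝓝[>] (0 : ℝ))
    (F := fun ε x => ENNReal.ofReal (ε * ‖g x‖ ^ ((n : ℝ) - ε))) (f := fun _ => 0)
    (fun x => ENNReal.ofReal (bound x)) ?_ ?_ ?_ ?_
  · simpa using key
  · refine Eventually.of_forall fun ε => ?_
    exact ((hgm.norm.measurable.pow_const _).const_mul _).ennreal_ofReal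
  · filter_upwards [hlt] with ε hε
    filter_upwards [hκ, hle] with x hx1 hx2
    refine ENNReal.ofReal_le_ofReal ?_
    have hκ0 : 0 < κ x := by linarith
    have hj0 : 0 ≤ j x := by
      by_contra hneg
      have h1 : κ x * j x < 0 := mul_neg_of_pos_of_neg hκ0 (not_le.1 hneg)
      have h2 : 0 ≤ c * ‖g x‖ ^ n := by positivity
      linarith
    have hθ : 0 < ε / n := div_pos hε.1 hn0
    have hθ1 : ε / n < 1 := (div_lt_one hn0).2 (by linarith)
    have hpow : ‖g x‖ ^ n ≤ κ x * (j x / c) := by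
      rw [← mul_div_assoc, le_div_iff₀ hc]; linarith
    have h1 : ‖g x‖ ^ ((n : ℝ) - ε) ≤ (κ x * (j x / c)) ^ (1 - ε / n) := by
      calc ‖g x‖ ^ ((n : ℝ) - ε) = (‖g x‖ ^ n) ^ (1 - ε / n) := by
            rw [← Real.rpow_natCast, ← Real.rpow_mul (norm_nonneg _)]
            congr 1; field_simp
        _ ≤ _ := Real.rpow_le_rpow (by positivity) hpow (by linarith)
    calc ε * ‖g x‖ ^ ((n : ℝ) - ε) ≤ ε * (κ x * (j x / c)) ^ (1 - ε / n) := by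
          gcongr; exact hε.1.le
      _ = n * (ε / n * (κ x * (j x / c)) ^ (1 - ε / n)) := by field_simp
      _ ≤ bound x := by
          refine mul_le_mul_of_nonneg_left ?_ hn0.le
          exact mul_rpow_one_sub_le hlam hx1 (by positivity) hθ hθ1
  · exact hbint.lintegral_lt_top.ne
  · refine Eventually.of_forall fun x => ?_
    rw [← ENNReal.ofReal_zero]
    refine ENNReal.tendsto_ofReal ?_
    -- The limiting exponent n is positive, so `rpow` is continuous there even at points where `g`
    -- vanishes.
    have hcont : ContinuousAt (fun ε : ℝ => ε * ‖g x‖ ^ ((n : ℝ) - ε)) 0 := by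
      refine continuousAt_id.mul ?_
      refine ContinuousAt.rpow continuousAt_const (by fun_prop) (Or.inr ?_)
      simpa using hn0
    have := hcont.tendsto.mono_left (nhdsWithin_le_nhds (s := Ioi 0))
    simpa using this

/-! ### Polar coordinates, Hölder's inequality and homotheties -/

section Sphere

variable {E : Type*} [NormedAddCommGroup E] [InnerProductSpace ℝ E] [FiniteDimensional ℝ E]
  [MeasurableSpace E] [BorelSpace E]

/-- Integration in polar coordinates. -/
theorem lintegral_eq_lintegral_toSphere [Nontrivial E] {F : E → ℝ≥0∞} (hF : Measurable F) :
    ∫⁻ x, F x = ∫⁻ θ : sphere (0 : E) 1, (∫⁻ t in Ioi (0 : ℝ),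
      ENNReal.ofReal (t ^ (Module.finrank ℝ E - 1)) * F (t • (θ : E)))
        ∂(volume : Measure E).toSphere := by
  have hmp := (volume : Measure E).measurePreserving_homeomorphUnitSphereProd
  have hG : Measurable fun q : sphere (0 : E) 1 × Ioi (0 : ℝ) => F ((q.2 : ℝ) • (q.1 : E)) := by
    fun_prop
  calc ∫⁻ x, F x = ∫⁻ x in ({0}ᶜ : Set E), F x := by rw [restrict_compl_singleton]
    _ = ∫⁻ x : ({0}ᶜ : Set E), F x ∂(volume.comap Subtype.val) :=
        (lintegral_subtype_comap (measurableSet_singleton _).compl F).symm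
    _ = ∫⁻ x : ({0}ᶜ : Set E), (fun q : sphere (0 : E) 1 × Ioi (0 : ℝ) =>
          F ((q.2 : ℝ) • (q.1 : E))) (homeomorphUnitSphereProd E x) ∂(volume.comap Subtype.val) := by
        refine lintegral_congr fun x => ?_
        have : ‖(x : E)‖ ≠ 0 := norm_ne_zero_iff.2 x.2
        simp [smul_smul, this]
    _ = ∫⁻ q, F ((q.2 : ℝ) • (q.1 : E)) ∂((volume : Measure E).toSphere.prod
          (Measure.volumeIoiPow (Module.finrank ℝ E - 1))) := hmp.lintegral_comp hG
    _ = ∫⁻ θ : sphere (0 : E) 1, ∫⁻ t : Ioi (0 : ℝ), F ((t : ℝ) • (θ : E))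
          ∂(Measure.volumeIoiPow (Module.finrank ℝ E - 1)) ∂(volume : Measure E).toSphere :=
        lintegral_prod _ hG.aemeasurable
    _ = _ := by
        refine lintegral_congr fun θ => ?_
        rw [Measure.volumeIoiPow, lintegral_withDensity_eq_lintegral_mul _ (by fun_prop)
          (by fun_prop), ← lintegral_subtype_comap measurableSet_Ioi]
        rfl

/-- A small set meets every ray in a short segment. -/
theorem setLIntegral_normalize_le [Nontrivial E] {H : E → ℝ≥0∞} (hH : Measurable H) {D : Set E}
    (hD : MeasurableSet D) {R s : ℝ} (hR : D ⊆ closedBall 0 R)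
    (hs : ediam D ≤ ENNReal.ofReal s) :
    ∫⁻ ξ in D, H (‖ξ‖⁻¹ • ξ) ≤ ENNReal.ofReal (R ^ (Module.finrank ℝ E - 1)) * ENNReal.ofReal s *
      ∫⁻ θ : sphere (0 : E) 1, H θ ∂(volume : Measure E).toSphere := by
  rw [← lintegral_indicator hD, lintegral_eq_lintegral_toSphere
    (Measurable.indicator (by fun_prop) hD), ← lintegral_const_mul _ (by fun_prop)]
  refine lintegral_mono fun θ => ?_
  have hθ : ‖(θ : E)‖ = 1 := by simp
  -- Along a unit vector, t ↦ tθ is an isometry, so `A` is no longer than the diameter of `D`; the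
  -- polar weight t^(d-1) is at most R^(d-1) on it.
  set A : Set ℝ := Ioi 0 ∩ (fun t : ℝ => t • (θ : E)) ⁻¹' D with hA
  have hAm : MeasurableSet A := measurableSet_Ioi.inter (hD.preimage (by fun_prop))
  have hAvol : volume A ≤ ENNReal.ofReal s := by
    refine (Real.volume_le_diam A).trans ((ediam_le fun t ht t' ht' => ?_).trans hs)
    refine le_trans (le_of_eq ?_) (edist_le_ediam_of_mem ht.2 ht'.2)
    simp only [edist_dist, dist_eq_norm]
    rw [← sub_smul, norm_smul, hθ, mul_one]
  calc ∫⁻ t in Ioi (0 : ℝ), ENNReal.ofReal (t ^ (Module.finrank ℝ E - 1)) *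
        D.indicator (fun ξ => H (‖ξ‖⁻¹ • ξ)) (t • (θ : E))
      ≤ ∫⁻ t in Ioi (0 : ℝ), A.indicator
          (fun _ => ENNReal.ofReal (R ^ (Module.finrank ℝ E - 1)) * H θ) t := by
        refine setLIntegral_mono' measurableSet_Ioi fun t (ht : 0 < t) => ?_
        by_cases htD : t • (θ : E) ∈ D
        · have htA : t ∈ A := ⟨ht, htD⟩
          have hnorm : ‖t • (θ : E)‖ = t := by rw [norm_smul, hθ, mul_one, Real.norm_of_nonneg ht.le]
          have htR : t ≤ R := by simpa [hnorm] using hR htD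
          rw [indicator_of_mem htA, indicator_of_mem htD, hnorm, smul_smul,
            inv_mul_cancel₀ ht.ne', one_smul]
          gcongr
        · rw [indicator_of_notMem htD, mul_zero]
          exact zero_le
    _ ≤ ∫⁻ t, A.indicator
          (fun _ => ENNReal.ofReal (R ^ (Module.finrank ℝ E - 1)) * H θ) t :=
        lintegral_mono' Measure.restrict_le_self le_rfl
    _ = ENNReal.ofReal (R ^ (Module.finrank ℝ E - 1)) * H θ * volume A := by
        rw [lintegral_indicator hAm, setLIntegral_const]
    _ ≤ ENNReal.ofReal (R ^ (Module.finrank ℝ E - 1)) * H θ * ENNReal.ofReal s := by gcongr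
    _ = _ := by ring

/-- Hölder's inequality against the constant 1; p = 1 is separate because its conjugate exponent is
infinite. -/
theorem lintegral_le_rpow_mul_rpow {α : Type*} [MeasurableSpace α] {μ : Measure α} {p : ℝ}
    (hp : 1 ≤ p) {f : α → ℝ≥0∞} (hf : AEMeasurable f μ) :
    ∫⁻ x, f x ∂μ ≤ (∫⁻ x, f x ^ p ∂μ) ^ (1 / p) * μ univ ^ (1 - 1 / p) := by
  rcases hp.eq_or_lt with rfl | hp
  · simp
  have hpq := Real.HolderConjugate.conjExponent hp
  have h := ENNReal.lintegral_mul_le_Lp_mul_Lq μ hpq hf (aemeasurable_const (b := (1 : ℝ≥0∞)))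
  have hq : 1 / p.conjExponent = 1 - 1 / p := by
    have := hpq.inv_add_inv_eq_one
    simp only [one_div]; linarith
  simpa [hq] using h

/-- Change of variables for homotheties. -/
theorem lintegral_comp_smul_add {F : E → ℝ≥0∞} (hF : Measurable F) {s : ℝ} (hs : 0 < s) (c : E) :
    ∫⁻ b, F (s • b + c) = ENNReal.ofReal (s ^ Module.finrank ℝ E)⁻¹ * ∫⁻ b, F b := by
  have h1 : ∫⁻ b, F (s • b + c) = ∫⁻ b, F (b + c) ∂(Measure.map (s • ·) volume) := by
    rw [lintegral_map (by fun_prop) (by fun_prop)]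
  rw [h1, Measure.map_addHaar_smul _ hs.ne', lintegral_smul_measure, lintegral_add_right_eq_self,
    abs_of_pos (by positivity), smul_eq_mul]

end Sphere

/-! ### Morrey's inequality on the unit sphere -/

section Sphere

variable {E : Type*} [NormedAddCommGroup E] [InnerProductSpace ℝ E] [FiniteDimensional ℝ E]
  [MeasurableSpace E] [BorelSpace E]

/-- Fundamental theorem of calculus along the radial projection of a segment to the sphere. -/
theorem enorm_sub_normalize_le {E : Type*} [NormedAddCommGroup E] [InnerProductSpace ℝ E]
    {v : E → ℝ} (hv : ContDiff ℝ 1 v) {x b : E} (hx : ‖x‖ = 1)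
    (hb : ‖b - x‖ ≤ 3 / 2) (hseg : ∀ s ∈ Icc (0 : ℝ) 1, 1 / 2 ≤ ‖x + s • (b - x)‖) :
    ‖v x - v (‖b‖⁻¹ • b)‖ₑ ≤ 6 * ∫⁻ s in Ioc (0 : ℝ) 1,
      ‖fderiv ℝ v (‖x + s • (b - x)‖⁻¹ • (x + s • (b - x)))‖ₑ := by
  set w := b - x with hw
  set c : ℝ → E := fun s => x + s • w with hc
  set N : ℝ → E := fun s => ‖c s‖⁻¹ • c s with hN
  have hcne : ∀ s ∈ Icc (0 : ℝ) 1, c s ≠ 0 := fun s hs h0 => by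
    have := hseg s hs
    rw [show x + s • w = 0 from h0, norm_zero] at this
    linarith
  have hcont : Continuous c := by fun_prop
  -- The derivative of the normalised path. Both of its terms have norm at most ‖w‖/‖c‖, with ‖w‖ ≤
  -- 3/2 and ‖c‖ ≥ 1/2, whence the constant 6 = 2 · 2 · (3/2).
  set N' : ℝ → E := fun s => ‖c s‖⁻¹ • w + (-(inner ℝ (c s) w / ‖c s‖) / ‖c s‖ ^ 2) • c s with hN'
  have hder : ∀ s ∈ Icc (0 : ℝ) 1, HasDerivAt N (N' s) s := by
    intro s hs
    have h1 : HasDerivAt c w s := by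
      have h := ((hasDerivAt_id s).smul_const w).const_add x
      rw [one_smul] at h
      exact h
    have h2 : HasDerivAt (fun s => ‖c s‖) (inner ℝ (c s) w / ‖c s‖) s := by
      have h3 := (h1.norm_sq).sqrt (by simpa using hcne s hs)
      simp only [Real.sqrt_sq (norm_nonneg _)] at h3
      convert h3 using 1
      rw [mul_div_mul_left _ _ two_ne_zero]
    exact (h2.inv (norm_ne_zero_iff.2 (hcne s hs))).smul h1
  have hN'c : ContinuousOn N' (Icc 0 1) := by
    have h0 : ∀ s ∈ Icc (0 : ℝ) 1, ‖c s‖ ≠ 0 := fun s hs => norm_ne_zero_iff.2 (hcne s hs)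
    have h0' : ∀ s ∈ Icc (0 : ℝ) 1, ‖c s‖ ^ 2 ≠ 0 := fun s hs => pow_ne_zero _ (h0 s hs)
    have h4 : ContinuousOn (fun s => ‖c s‖⁻¹) (Icc 0 1) := hcont.norm.continuousOn.inv₀ h0
    have h5 : ContinuousOn (fun s => inner ℝ (c s) w / ‖c s‖) (Icc 0 1) :=
      (hcont.inner continuous_const).continuousOn.div hcont.norm.continuousOn h0
    exact (h4.smul continuousOn_const).add
      ((h5.neg.div (hcont.norm.pow 2).continuousOn h0').smul hcont.continuousOn)
  have hNc : ContinuousOn N (Icc 0 1) := fun s hs => (hder s hs).continuousAt.continuousWithinAt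
  have hvd : ∀ s ∈ Icc (0 : ℝ) 1, HasDerivAt (fun s => v (N s)) (fderiv ℝ v (N s) (N' s)) s :=
    fun s hs => ((hv.differentiable one_ne_zero) (N s)).hasFDerivAt.comp_hasDerivAt s (hder s hs)
  have hint : IntervalIntegrable (fun s => fderiv ℝ v (N s) (N' s)) volume 0 1 := by
    refine ContinuousOn.intervalIntegrable ?_
    rw [uIcc_of_le zero_le_one]
    exact ((hv.continuous_fderiv one_ne_zero).comp_continuousOn hNc).clm_apply hN'c
  have hFTC := intervalIntegral.integral_eq_sub_of_hasDerivAt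
    (fun s hs => hvd s (by rwa [uIcc_of_le zero_le_one] at hs)) hint
  have hN0 : N 0 = x := by simp [hN, hc, hx]
  have hN1 : N 1 = ‖b‖⁻¹ • b := by simp only [hN, hc, hw, one_smul, add_sub_cancel]
  rw [hN0, hN1, intervalIntegral.integral_of_le zero_le_one] at hFTC
  rw [← enorm_neg, neg_sub, ← hFTC, ← lintegral_const_mul' _ _ (by simp)]
  refine (enorm_integral_le_lintegral_enorm _).trans ?_
  refine setLIntegral_mono' measurableSet_Ioc fun s hs => ?_
  have hs' : s ∈ Icc (0 : ℝ) 1 := Ioc_subset_Icc_self hs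
  have hcs : 1 / 2 ≤ ‖c s‖ := hseg s hs'
  have hcpos : 0 < ‖c s‖ := by linarith
  have hN'n : ‖N' s‖ ≤ 6 := by
    have h6 : ‖c s‖⁻¹ ≤ 2 := by
      rw [inv_le_comm₀ hcpos two_pos]; linarith
    have h7 : |inner ℝ (c s) w| ≤ ‖c s‖ * ‖w‖ := abs_real_inner_le_norm _ _
    calc ‖N' s‖ ≤ ‖‖c s‖⁻¹ • w‖ + ‖(-(inner ℝ (c s) w / ‖c s‖) / ‖c s‖ ^ 2) • c s‖ :=
          norm_add_le _ _
      _ = ‖c s‖⁻¹ * ‖w‖ + |inner ℝ (c s) w| / ‖c s‖ / ‖c s‖ ^ 2 * ‖c s‖ := by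
          simp [norm_smul]
      _ ≤ ‖c s‖⁻¹ * ‖w‖ + (‖c s‖ * ‖w‖) / ‖c s‖ / ‖c s‖ ^ 2 * ‖c s‖ := by gcongr
      _ = 2 * (‖c s‖⁻¹ * ‖w‖) := by field_simp; ring
      _ ≤ 2 * (2 * (3 / 2)) := by gcongr
      _ = 6 := by norm_num
  calc ‖fderiv ℝ v (N s) (N' s)‖ₑ ≤ ‖fderiv ℝ v (N s)‖ₑ * ‖N' s‖ₑ :=
        ContinuousLinearMap.le_opENorm _ _
    _ ≤ ‖fderiv ℝ v (N s)‖ₑ * 6 := by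
        gcongr
        rw [← ofReal_norm]
        exact (ENNReal.ofReal_le_ofReal hN'n).trans (by simp)
    _ = _ := mul_comm _ _

/-- The `p`-energy of a zero-homogeneous function on a ball of radius `s / 2` near the sphere,
rescaled to a ball of radius `1 / 2`. -/
theorem setLIntegral_homothety_le [Nontrivial E] {H : E → ℝ≥0∞} (hH : Measurable H) {x y : E}
    (hx : ‖x‖ = 1) (hy : ‖y‖ = 1) {s : ℝ} (hs : 0 < s) (hs1 : s ≤ 1) :
    ∫⁻ b in ball (x + y) (1 / 2),
      H (‖x + s • (b - x)‖⁻¹ • (x + s • (b - x))) ≤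
      ENNReal.ofReal (s ^ Module.finrank ℝ E)⁻¹ *
        (ENNReal.ofReal (3 ^ (Module.finrank ℝ E - 1)) * ENNReal.ofReal s *
          ∫⁻ θ : sphere (0 : E) 1, H θ ∂(volume : Measure E).toSphere) := by
  have hD : MeasurableSet (ball (x + s • y) (s / 2)) := measurableSet_ball
  have hmem : ∀ b, b ∈ ball (x + y) (1 / 2) ↔ s • b + (x - s • x) ∈ ball (x + s • y) (s / 2) := by
    intro b
    rw [mem_ball, mem_ball, dist_eq_norm, dist_eq_norm,
      show s • b + (x - s • x) - (x + s • y) = s • (b - (x + y)) by module, norm_smul,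
      Real.norm_of_nonneg hs.le]
    constructor <;> intro h <;> nlinarith
  have hmeas : Measurable fun ξ : E => H (‖ξ‖⁻¹ • ξ) := by fun_prop
  have h1 : ∫⁻ b in ball (x + y) (1 / 2), H (‖x + s • (b - x)‖⁻¹ • (x + s • (b - x))) =
      ∫⁻ b, (ball (x + s • y) (s / 2)).indicator (fun ξ => H (‖ξ‖⁻¹ • ξ))
        (s • b + (x - s • x)) := by
    rw [← lintegral_indicator measurableSet_ball]
    refine lintegral_congr fun b => ?_
    by_cases hb : b ∈ ball (x + y) (1 / 2)
    · rw [indicator_of_mem hb, indicator_of_mem ((hmem b).1 hb),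
        show s • b + (x - s • x) = x + s • (b - x) by module]
    · rw [indicator_of_notMem hb, indicator_of_notMem fun h => hb ((hmem b).2 h)]
  rw [h1, lintegral_comp_smul_add (hmeas.indicator hD) hs, lintegral_indicator hD]
  gcongr
  -- The homothety with centre `x` and ratio `s` carries the ball to one of diameter at most `s`
  -- around x + sy, inside the ball of radius 3. The Jacobian costs s^(-d), but radial thinness
  -- returns a factor s, so the net loss is s^(1-d).
  refine setLIntegral_normalize_le hH hD (fun ξ hξ => ?_) ?_
  · rw [mem_ball, dist_eq_norm] at hξ
    rw [mem_closedBall_zero_iff]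
    have h2 : ‖x + s • y‖ ≤ 1 + s := by
      refine (norm_add_le _ _).trans ?_
      rw [norm_smul, hx, hy, Real.norm_of_nonneg hs.le, mul_one]
    have h3 := norm_add_le (ξ - (x + s • y)) (x + s • y)
    rw [sub_add_cancel] at h3
    linarith
  · refine ediam_le fun a ha b hb => ?_
    rw [edist_dist]
    refine ENNReal.ofReal_le_ofReal ?_
    rw [mem_ball] at ha hb
    linarith [dist_triangle_right a b (x + s • y)]

/-- The integral equals p / (p - (d - 1)), and p - (d - 1) ≥ 1/2. Keeping `p` a fixed distance above
the critical exponent d - 1 is what makes the Morrey constant uniform in `p`. -/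
theorem lintegral_rpow_neg_le {d : ℕ} {p : ℝ} (hp : (d : ℝ) - 1 / 2 ≤ p) (hpd : p ≤ d)
    (hd : 1 ≤ d) :
    ∫⁻ s in Ioc (0 : ℝ) 1, ENNReal.ofReal (s ^ ((1 - (d : ℝ)) / p)) ≤ ENNReal.ofReal (2 * d) := by
  have hd1 : (1 : ℝ) ≤ d := by exact_mod_cast hd
  have hp0 : 0 < p := by linarith
  have hexp : -1 < (1 - (d : ℝ)) / p := by rw [lt_div_iff₀ hp0]; linarith
  have hii := intervalIntegral.intervalIntegrable_rpow' (a := 0) (b := 1) hexp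
  rw [← ofReal_integral_eq_lintegral_ofReal
    ((intervalIntegrable_iff_integrableOn_Ioc_of_le zero_le_one).1 hii)]
  · refine ENNReal.ofReal_le_ofReal ?_
    rw [← intervalIntegral.integral_of_le zero_le_one, integral_rpow (Or.inl hexp)]
    rw [Real.one_rpow, Real.zero_rpow (by linarith), sub_zero, div_le_iff₀ (by linarith)]
    have : (1 - (d : ℝ)) / p + 1 = (p - (d - 1)) / p := by field_simp; ring
    rw [this, ← mul_div_assoc, le_div_iff₀ hp0]
    nlinarith
  · filter_upwards [ae_restrict_mem measurableSet_Ioc] with s hs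
    exact Real.rpow_nonneg hs.1.le _

/-- For fixed `s`, Hölder's inequality in `b` and the homothety estimate give a bound of order
s^((1-d)/p). This is integrable over (0, 1] since p > d - 1, so exchanging the two integrals
finishes the estimate. -/
theorem lintegral_segments_le [Nontrivial E] {G : E → ℝ≥0∞} (hG : Measurable G) {x y : E}
    (hx : ‖x‖ = 1) (hy : ‖y‖ = 1) {p : ℝ} (hp1 : 1 < p)
    (hp : (Module.finrank ℝ E : ℝ) - 1 / 2 ≤ p) (hpd : p ≤ Module.finrank ℝ E) :
    ∫⁻ b in ball (x + y) (1 / 2), ∫⁻ s in Ioc (0 : ℝ) 1,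
      G (‖x + s • (b - x)‖⁻¹ • (x + s • (b - x))) ≤
      ENNReal.ofReal (2 * Module.finrank ℝ E) *
        (ENNReal.ofReal (3 ^ (Module.finrank ℝ E - 1)) *
          ∫⁻ θ : sphere (0 : E) 1, G θ ^ p ∂(volume : Measure E).toSphere) ^ (1 / p) *
        volume (ball (0 : E) (1 / 2)) ^ (1 - 1 / p) := by
  have hd : 1 ≤ Module.finrank ℝ E := Module.finrank_pos
  set d := Module.finrank ℝ E with hdd
  set V := volume (ball (0 : E) (1 / 2)) with hV
  set A := ENNReal.ofReal (3 ^ (d - 1)) *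
          ∫⁻ θ : sphere (0 : E) 1, G θ ^ p ∂(volume : Measure E).toSphere with hA
  have hp0 : 0 < p := by linarith
  rw [lintegral_lintegral_swap (by fun_prop)]
  calc ∫⁻ s in Ioc (0 : ℝ) 1, ∫⁻ b in ball (x + y) (1 / 2),
        G (‖x + s • (b - x)‖⁻¹ • (x + s • (b - x)))
      ≤ ∫⁻ s in Ioc (0 : ℝ) 1, ENNReal.ofReal (s ^ ((1 - (d : ℝ)) / p)) *
          (A ^ (1 / p) * V ^ (1 - 1 / p)) := by
        refine setLIntegral_mono' measurableSet_Ioc fun s hs => ?_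
        refine (lintegral_le_rpow_mul_rpow hp1.le (by fun_prop)).trans ?_
        rw [Measure.restrict_apply_univ, Measure.addHaar_ball_center, ← mul_assoc]
        gcongr
        have h1 := setLIntegral_homothety_le (hG.pow_const p) hx hy hs.1 hs.2
        refine (ENNReal.rpow_le_rpow h1 (by positivity)).trans (le_of_eq ?_)
        have h2 : ENNReal.ofReal (s ^ d)⁻¹ * (ENNReal.ofReal (3 ^ (d - 1)) * ENNReal.ofReal s *
            ∫⁻ θ : sphere (0 : E) 1, G θ ^ p ∂(volume : Measure E).toSphere) =
            ENNReal.ofReal (s ^ (1 - (d : ℝ))) * A := by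
          have h3 : ENNReal.ofReal (s ^ (1 - (d : ℝ))) =
              ENNReal.ofReal (s ^ d)⁻¹ * ENNReal.ofReal s := by
            rw [← ENNReal.ofReal_mul (by have := hs.1; positivity), Real.rpow_sub hs.1,
              Real.rpow_one, Real.rpow_natCast, div_eq_inv_mul]
          rw [h3, hA]; ring
        rw [h2, ENNReal.mul_rpow_of_nonneg _ _ (by positivity),
          ENNReal.ofReal_rpow_of_nonneg (Real.rpow_nonneg hs.1.le _) (by positivity),
          ← Real.rpow_mul hs.1.le, mul_one_div]
    _ = (∫⁻ s in Ioc (0 : ℝ) 1, ENNReal.ofReal (s ^ ((1 - (d : ℝ)) / p))) *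
          (A ^ (1 / p) * V ^ (1 - 1 / p)) := lintegral_mul_const _ (by fun_prop)
    _ ≤ ENNReal.ofReal (2 * d) * (A ^ (1 / p) * V ^ (1 - 1 / p)) := by
        gcongr
        exact lintegral_rpow_neg_le hp hpd hd
    _ = _ := (mul_assoc _ _ _).symm

/-- For x and y at an angle of at most π/2, ‖x + sy‖ ≥ 1, and moving the endpoint within the ball
changes the point by at most 1/2. Thus the segment avoids the origin and can be projected to the
sphere. -/
theorem half_le_norm_of_mem_ball {E : Type*} [NormedAddCommGroup E] [InnerProductSpace ℝ E]
    {x y b : E} (hx : ‖x‖ = 1) (hy : ‖y‖ = 1)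
    (hxy : 0 ≤ inner ℝ x y) (hb : b ∈ ball (x + y) (1 / 2)) {s : ℝ} (hs : s ∈ Icc (0 : ℝ) 1) :
    1 / 2 ≤ ‖x + s • (b - x)‖ := by
  rw [mem_ball, dist_eq_norm] at hb
  have h1 : 1 ≤ ‖x + s • y‖ := by
    have h2 : ‖x + s • y‖ ^ 2 = 1 + 2 * (s * inner ℝ x y) + s ^ 2 := by
      rw [norm_add_sq_real, norm_smul, inner_smul_right, hx, hy, Real.norm_of_nonneg hs.1]
      ring
    have h3 : 0 ≤ s * inner ℝ x y := mul_nonneg hs.1 hxy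
    nlinarith [norm_nonneg (x + s • y), sq_nonneg s]
  have h4 : ‖s • (b - (x + y))‖ ≤ 1 / 2 := by
    rw [norm_smul, Real.norm_of_nonneg hs.1]
    nlinarith [hs.2, norm_nonneg (b - (x + y)), hs.1]
  have h5 := norm_sub_le (x + s • (b - x)) (s • (b - (x + y)))
  rw [show x + s • (b - x) - s • (b - (x + y)) = x + s • y by module] at h5
  linarith

theorem norm_sub_le_of_mem_ball {E : Type*} [NormedAddCommGroup E]
    {x y b : E} (hy : ‖y‖ = 1) (hb : b ∈ ball (x + y) (1 / 2)) :
    ‖b - x‖ ≤ 3 / 2 := by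
  rw [mem_ball, dist_eq_norm] at hb
  have := norm_add_le (b - (x + y)) y
  rw [show b - (x + y) + y = b - x by abel] at this
  linarith

/-- Morrey's averaging argument: `x` and `y` are both joined to the same point b/‖b‖ by radially
projected segments, and the result is averaged over `b` in a ball around x + y. The constant 12 is 6
for each of the two paths. -/
theorem enorm_sub_rpow_le_of_inner_nonneg [Nontrivial E] {v : E → ℝ} (hv : ContDiff ℝ 1 v)
    {x y : E} (hx : ‖x‖ = 1) (hy : ‖y‖ = 1) (hxy : 0 ≤ inner ℝ x y) {p : ℝ} (hp1 : 1 < p)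
    (hp : (Module.finrank ℝ E : ℝ) - 1 / 2 ≤ p) (hpd : p ≤ Module.finrank ℝ E) :
    volume (ball (0 : E) (1 / 2)) * ‖v x - v y‖ₑ ^ p ≤
      (12 * ENNReal.ofReal (2 * Module.finrank ℝ E)) ^ p *
        (ENNReal.ofReal (3 ^ (Module.finrank ℝ E - 1)) *
          ∫⁻ θ : sphere (0 : E) 1, ‖fderiv ℝ v θ‖ₑ ^ p ∂(volume : Measure E).toSphere) := by
  have hG : Measurable fun ξ : E => ‖fderiv ℝ v ξ‖ₑ :=
    (hv.continuous_fderiv one_ne_zero).enorm.measurable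
  have hx' := lintegral_segments_le hG hx hy hp1 hp hpd
  have hy' := lintegral_segments_le hG hy hx hp1 hp hpd
  rw [add_comm y x] at hy'
  have hp0 : 0 < p := by linarith
  set d := Module.finrank ℝ E
  set V := volume (ball (0 : E) (1 / 2)) with hV
  have hV0 : V ≠ 0 := (measure_ball_pos _ _ (by norm_num)).ne'
  have hVt : V ≠ ∞ := measure_ball_lt_top.ne
  set A := ENNReal.ofReal (3 ^ (d - 1)) *
    ∫⁻ θ : sphere (0 : E) 1, ‖fderiv ℝ v θ‖ₑ ^ p ∂(volume : Measure E).toSphere with hA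
  set M := ENNReal.ofReal (2 * d) * A ^ (1 / p) * V ^ (1 - 1 / p) with hM
  have hmeas : ∀ x : E, Measurable fun b : E => ∫⁻ s in Ioc (0 : ℝ) 1,
      ‖fderiv ℝ v (‖x + s • (b - x)‖⁻¹ • (x + s • (b - x)))‖ₑ := fun x => by
    refine Measurable.lintegral_prod_right' (f := fun q : E × ℝ =>
      ‖fderiv ℝ v (‖x + q.2 • (q.1 - x)‖⁻¹ • (x + q.2 • (q.1 - x)))‖ₑ) ?_
    exact hG.comp (by fun_prop)
  have hsum : V * ‖v x - v y‖ₑ ≤ 12 * M := by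
    calc V * ‖v x - v y‖ₑ = ∫⁻ _ in ball (x + y) (1 / 2), ‖v x - v y‖ₑ := by
          rw [setLIntegral_const, Measure.addHaar_ball_center, mul_comm]
      _ ≤ ∫⁻ b in ball (x + y) (1 / 2), (6 * (∫⁻ s in Ioc (0 : ℝ) 1,
            ‖fderiv ℝ v (‖x + s • (b - x)‖⁻¹ • (x + s • (b - x)))‖ₑ) +
            6 * ∫⁻ s in Ioc (0 : ℝ) 1,
            ‖fderiv ℝ v (‖y + s • (b - y)‖⁻¹ • (y + s • (b - y)))‖ₑ) := by
          refine setLIntegral_mono' measurableSet_ball fun b hb => ?_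
          have hb' : b ∈ ball (y + x) (1 / 2) := by rwa [add_comm]
          have hyx : 0 ≤ inner ℝ y x := by rwa [real_inner_comm]
          have h1 := enorm_sub_normalize_le hv hx (norm_sub_le_of_mem_ball hy hb)
            fun s hs => half_le_norm_of_mem_ball hx hy hxy hb hs
          have h2 := enorm_sub_normalize_le hv hy (norm_sub_le_of_mem_ball hx hb')
            fun s hs => half_le_norm_of_mem_ball hy hx hyx hb' hs
          refine le_trans ?_ (add_le_add h1 h2)
          rw [← edist_eq_enorm_sub, ← edist_eq_enorm_sub, ← edist_eq_enorm_sub]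
          exact edist_triangle_right _ _ _
      _ ≤ 6 * M + 6 * M := by
          rw [lintegral_add_left ((hmeas x).const_mul _), lintegral_const_mul _ (hmeas x),
            lintegral_const_mul _ (hmeas y)]
          gcongr
      _ = 12 * M := by ring
  -- After raising to the power `p`, both sides carry the factor V^(p-1), which cancels.
  have hpow := ENNReal.rpow_le_rpow hsum hp0.le
  have hVp : V ^ (p - 1) ≠ 0 := (ENNReal.rpow_pos (pos_iff_ne_zero.2 hV0) hVt).ne'
  have hVp' : V ^ (p - 1) ≠ ∞ := ENNReal.rpow_ne_top_of_nonneg (by linarith) hVt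
  have e1 : (V * ‖v x - v y‖ₑ) ^ p = V ^ (p - 1) * (V * ‖v x - v y‖ₑ ^ p) := by
    rw [ENNReal.mul_rpow_of_nonneg _ _ hp0.le, ← mul_assoc]
    congr 1
    conv_rhs => rw [← ENNReal.rpow_one V, ← ENNReal.rpow_mul, one_mul]
    rw [← ENNReal.rpow_add _ _ hV0 hVt]
    congr 1; ring
  have e2 : (12 * M) ^ p = V ^ (p - 1) * ((12 * ENNReal.ofReal (2 * d)) ^ p * A) := by
    rw [hM, show 12 * (ENNReal.ofReal (2 * d) * A ^ (1 / p) * V ^ (1 - 1 / p)) =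
      (12 * ENNReal.ofReal (2 * d)) * A ^ (1 / p) * V ^ (1 - 1 / p) by ring,
      ENNReal.mul_rpow_of_nonneg _ _ hp0.le, ENNReal.mul_rpow_of_nonneg _ _ hp0.le,
      ← ENNReal.rpow_mul, ← ENNReal.rpow_mul, one_div_mul_cancel hp0.ne', ENNReal.rpow_one,
      show (1 - 1 / p) * p = p - 1 by field_simp]
    ring
  rw [e1, e2] at hpow
  exact (ENNReal.mul_le_mul_iff_right hVp hVp').1 hpow

/-- Morrey's inequality on the unit sphere, with a constant that is uniform in the exponent. -/
theorem exists_enorm_sub_rpow_le_lintegral_sphere (hd : 2 ≤ Module.finrank ℝ E) :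
    ∃ C : ℝ, 0 < C ∧ ∀ v : E → ℝ, ContDiff ℝ 1 v → ∀ p : ℝ,
      (Module.finrank ℝ E : ℝ) - 1 / 2 ≤ p → p ≤ Module.finrank ℝ E →
      ∀ x y : E, ‖x‖ = 1 → ‖y‖ = 1 → ‖v x - v y‖ₑ ^ p ≤ ENNReal.ofReal C *
        ∫⁻ θ : sphere (0 : E) 1, ‖fderiv ℝ v θ‖ₑ ^ p ∂(volume : Measure E).toSphere := by
  have : Nontrivial E := Module.nontrivial_of_finrank_pos (R := ℝ) (by omega)
  set d := Module.finrank ℝ E with hdd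
  set V := volume (ball (0 : E) (1 / 2)) with hV
  have hV0 : V ≠ 0 := (measure_ball_pos _ _ (by norm_num)).ne'
  have hVt : V ≠ ∞ := measure_ball_lt_top.ne
  -- The exponent `d` replaces `p` on bases that are at least 1, so the constant does not depend on
  -- `p`. The factor 2^d pays for passing through an intermediate point when x and y form an obtuse
  -- angle.
  set C₀ : ℝ≥0∞ := 2 ^ (d : ℝ) * (V⁻¹ * ((12 * ENNReal.ofReal (2 * d)) ^ (d : ℝ) *
    ENNReal.ofReal (3 ^ (d - 1)))) with hC₀
  have hC₀t : C₀ ≠ ∞ := by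
    refine ENNReal.mul_ne_top (ENNReal.rpow_ne_top_of_nonneg (by positivity) (by simp))
      (ENNReal.mul_ne_top (ENNReal.inv_ne_top.2 hV0) (ENNReal.mul_ne_top
        (ENNReal.rpow_ne_top_of_nonneg (by positivity)
          (ENNReal.mul_ne_top (by simp) ENNReal.ofReal_ne_top)) (by simp)))
  refine ⟨C₀.toReal + 1, by positivity, fun v hv p hp hpd x y hx hy => ?_⟩
  have hd2 : (2 : ℝ) ≤ d := by exact_mod_cast hd
  have hp1 : 1 < p := by linarith
  have hp0 : 0 < p := by linarith
  set S₀ := ∫⁻ θ : sphere (0 : E) 1, ‖fderiv ℝ v θ‖ₑ ^ p ∂(volume : Measure E).toSphere with hS₀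
  set C₁ : ℝ≥0∞ := V⁻¹ * ((12 * ENNReal.ofReal (2 * d)) ^ (d : ℝ) *
    ENNReal.ofReal (3 ^ (d - 1))) with hC₁
  have hone : 1 ≤ 12 * ENNReal.ofReal (2 * d) := by
    have h1 : 1 ≤ ENNReal.ofReal (2 * d) := ENNReal.one_le_ofReal.2 (by linarith)
    calc (1 : ℝ≥0∞) ≤ ENNReal.ofReal (2 * d) := h1
      _ ≤ 12 * ENNReal.ofReal (2 * d) := le_mul_of_one_le_left (by simp) (by norm_num)
  have key : ∀ x y : E, ‖x‖ = 1 → ‖y‖ = 1 → 0 ≤ inner ℝ x y →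
      ‖v x - v y‖ₑ ≤ (C₁ * S₀) ^ (1 / p) := by
    intro x y hx hy hxy
    have h := enorm_sub_rpow_le_of_inner_nonneg hv hx hy hxy hp1 hp hpd
    rw [mul_comm, ← ENNReal.le_div_iff_mul_le (Or.inl hV0) (Or.inl hVt)] at h
    rw [one_div, ENNReal.le_rpow_inv_iff hp0]
    refine h.trans ?_
    rw [div_eq_mul_inv, mul_comm, hC₁, mul_assoc, mul_assoc]
    gcongr
  have key2 : ‖v x - v y‖ₑ ≤ 2 * (C₁ * S₀) ^ (1 / p) := by
    rcases le_total 0 (inner ℝ x y) with hxy | hxy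
    · refine (key x y hx hy hxy).trans (le_mul_of_one_le_left (by simp) (by norm_num))
    -- A unit vector orthogonal to `x` exists because d ≥ 2; its sign is chosen so that it makes no
    -- obtuse angle with `y`.
    · obtain ⟨w, hw1, hxw, hyw⟩ : ∃ w : E, ‖w‖ = 1 ∧ 0 ≤ inner ℝ x w ∧ 0 ≤ inner ℝ w y := by
        obtain ⟨w₀, hw₀, hw₁⟩ : ∃ w : E, inner ℝ x w = 0 ∧ ‖w‖ = 1 := by
          have hx0 : x ≠ 0 := by rintro rfl; simp at hx
          have hf : 0 < Module.finrank ℝ (ℝ ∙ x)ᗮ := by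
            have h1 := Submodule.finrank_add_finrank_orthogonal (ℝ ∙ x)
            rw [finrank_span_singleton hx0] at h1
            omega
          have := Module.nontrivial_of_finrank_pos hf
          obtain ⟨w, hw⟩ := exists_norm_eq (ℝ ∙ x)ᗮ zero_le_one
          exact ⟨w, Submodule.mem_orthogonal_singleton_iff_inner_right.1 w.2, by simpa using hw⟩
        rcases le_total 0 (inner ℝ w₀ y) with h | h
        · exact ⟨w₀, hw₁, hw₀.ge, h⟩
        · exact ⟨-w₀, by simpa using hw₁, by simp [hw₀], by simpa using h⟩
      have h1 := key x w hx hw1 hxw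
      have h2 := key w y hw1 hy hyw
      calc ‖v x - v y‖ₑ ≤ ‖v x - v w‖ₑ + ‖v w - v y‖ₑ := by
            rw [← edist_eq_enorm_sub, ← edist_eq_enorm_sub, ← edist_eq_enorm_sub]
            exact edist_triangle _ _ _
        _ ≤ _ := by rw [two_mul]; exact add_le_add h1 h2
  calc ‖v x - v y‖ₑ ^ p ≤ (2 * (C₁ * S₀) ^ (1 / p)) ^ p := ENNReal.rpow_le_rpow key2 hp0.le
    _ = 2 ^ p * (C₁ * S₀) := by
        rw [ENNReal.mul_rpow_of_nonneg _ _ hp0.le, ← ENNReal.rpow_mul, one_div_mul_cancel hp0.ne',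
          ENNReal.rpow_one]
    _ ≤ 2 ^ (d : ℝ) * (C₁ * S₀) := by
        gcongr
        norm_num
    _ = C₀ * S₀ := by rw [hC₀, ← mul_assoc (2 ^ (d : ℝ)) C₁ S₀]
    _ ≤ _ := by
        gcongr
        rw [← ENNReal.ofReal_toReal hC₀t]
        exact ENNReal.ofReal_le_ofReal (by simp)

end Sphere

/-! ### Mollification and approximation by smooth functions -/

open scoped Convolution

/-- Convergence almost everywhere without loss of mass implies convergence in `L¹`. -/
theorem tendsto_lintegral_enorm_sub_of_lintegral_le {α G : Type*} [MeasurableSpace α]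
    {μ : Measure α} [NormedAddCommGroup G] {f : ℕ → α → G} {g : α → G}
    (hf : ∀ k, AEStronglyMeasurable (f k) μ) (hg : AEStronglyMeasurable g μ)
    (hlim : ∀ᵐ x ∂μ, Tendsto (fun k => f k x) atTop (𝓝 (g x)))
    (hle : ∀ k, ∫⁻ x, ‖f k x‖ₑ ∂μ ≤ ∫⁻ x, ‖g x‖ₑ ∂μ) (hfin : ∫⁻ x, ‖g x‖ₑ ∂μ ≠ ∞) :
    Tendsto (fun k => ∫⁻ x, ‖f k x - g x‖ₑ ∂μ) atTop (𝓝 0) := by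
  set I := ∫⁻ x, ‖g x‖ₑ ∂μ with hI
  have htri : ∀ k x, ‖f k x - g x‖ₑ ≤ ‖f k x‖ₑ + ‖g x‖ₑ := fun k x => enorm_sub_le
  -- These functions are nonnegative by the triangle inequality and converge to 2‖g‖, so Fatou's
  -- lemma turns the bound on the masses into decay of ∫ ‖f_k - g‖.
  set h : ℕ → α → ℝ≥0∞ := fun k x => ‖f k x‖ₑ + ‖g x‖ₑ - ‖f k x - g x‖ₑ with hh
  have hhm : ∀ k, AEMeasurable (h k) μ := fun k =>
    ((hf k).enorm.add hg.enorm).sub ((hf k).sub hg).enorm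
  have hsum : ∀ k, ∫⁻ x, h k x ∂μ + ∫⁻ x, ‖f k x - g x‖ₑ ∂μ ≤ 2 * I := by
    intro k
    rw [← lintegral_add_left' (hhm k)]
    calc ∫⁻ x, h k x + ‖f k x - g x‖ₑ ∂μ = ∫⁻ x, ‖f k x‖ₑ + ‖g x‖ₑ ∂μ :=
          lintegral_congr fun x => tsub_add_cancel_of_le (htri k x)
      _ = ∫⁻ x, ‖f k x‖ₑ ∂μ + I := lintegral_add_left' (hf k).enorm _
      _ ≤ 2 * I := by rw [two_mul]; gcongr; exact hle k
  have hfatou : 2 * I ≤ liminf (fun k => ∫⁻ x, h k x ∂μ) atTop := by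
    refine le_trans (le_of_eq ?_) (lintegral_liminf_le' hhm)
    rw [hI, ← lintegral_const_mul' _ _ (by simp)]
    refine lintegral_congr_ae ?_
    filter_upwards [hlim] with x hx
    have h1 : Tendsto (fun k => ‖f k x‖ₑ) atTop (𝓝 ‖g x‖ₑ) := hx.enorm
    have h2 : Tendsto (fun k => ‖f k x - g x‖ₑ) atTop (𝓝 0) := by
      have := (hx.sub_const (g x)).enorm
      simpa using this
    have h3 := ENNReal.Tendsto.sub (h1.add_const ‖g x‖ₑ) h2 (Or.inr ENNReal.zero_ne_top)
    rw [tsub_zero, ← two_mul] at h3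
    exact h3.liminf_eq.symm
  rw [ENNReal.tendsto_nhds_zero]
  intro ε hε
  rcases eq_or_ne I 0 with h0 | h0
  · refine Eventually.of_forall fun k => le_trans (le_trans le_add_self (hsum k)) ?_
    simp [h0]
  · have hlt : 2 * I - ε < liminf (fun k => ∫⁻ x, h k x ∂μ) atTop :=
      (ENNReal.sub_lt_self (ENNReal.mul_ne_top (by simp) hfin) (by simpa using h0)
        hε.ne').trans_le hfatou
    filter_upwards [eventually_lt_of_lt_liminf hlt] with k hk
    have h5 : 2 * I ≤ ∫⁻ x, h k x ∂μ + ε := tsub_le_iff_right.1 hk.le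
    have hhfin : ∫⁻ x, h k x ∂μ ≠ ∞ :=
      ne_top_of_le_ne_top (ENNReal.mul_ne_top (by simp) hfin) (le_self_add.trans (hsum k))
    exact (ENNReal.add_le_add_iff_left hhfin).1 ((hsum k).trans h5)

theorem integrable_indicator_of_integrableOn {α G : Type*} [MeasurableSpace α] {μ : Measure α}
    [NormedAddCommGroup G] {f : α → G} {B : Set α} (hf : IntegrableOn f B μ)
    (hB : MeasurableSet B) : Integrable (B.indicator f) μ :=
  hf.integrable_indicator hB

theorem lintegral_enorm_indicator_rpow {α G : Type*} [MeasurableSpace α] {μ : Measure α}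
    [NormedAddCommGroup G] (f : α → G) {B : Set α} (hB : MeasurableSet B) {p : ℝ} (hp : 0 < p) :
    ∫⁻ x, ‖B.indicator f x‖ₑ ^ p ∂μ = ∫⁻ x in B, ‖f x‖ₑ ^ p ∂μ := by
  rw [← lintegral_indicator hB]
  refine lintegral_congr fun x => ?_
  by_cases hx : x ∈ B
  · simp [hx]
  · simp [hx, hp]

section Mollifier

variable {E : Type*} [NormedAddCommGroup E] [InnerProductSpace ℝ E] [FiniteDimensional ℝ E]
  [MeasurableSpace E] [BorelSpace E] {G : Type*} [NormedAddCommGroup G] [NormedSpace ℝ G]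

/-- Young's inequality for the convolution with a bump function. -/
theorem lintegral_enorm_convolution_rpow_le (φ : ContDiffBump (0 : E)) {g : E → G}
    (hg : AEStronglyMeasurable g) {p : ℝ} (hp : 1 ≤ p) :
    ∫⁻ x, ‖(φ.normed volume ⋆[ContinuousLinearMap.lsmul ℝ ℝ, volume] g) x‖ₑ ^ p ≤
      ∫⁻ x, ‖g x‖ₑ ^ p := by
  wlog hgm : StronglyMeasurable g generalizing g
  · have h := this hg.stronglyMeasurable_mk.aestronglyMeasurable hg.stronglyMeasurable_mk
    rw [← convolution_congr _ EventuallyEq.rfl hg.ae_eq_mk] at h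
    refine h.trans (le_of_eq (lintegral_congr_ae ?_))
    filter_upwards [hg.ae_eq_mk] with x hx
    rw [hx]
  have hp0 : 0 < p := by linarith
  set ρ : E → ℝ≥0∞ := fun y => ENNReal.ofReal (φ.normed volume y) with hρ
  have hρm : Measurable ρ := φ.continuous_normed.measurable.ennreal_ofReal
  -- The bump is the density of a probability measure, so Hölder's inequality gives the pointwise
  -- Jensen bound; Tonelli and translation invariance then give the norm bound.
  set ν : Measure E := volume.withDensity ρ with hν
  have hν1 : ν univ = 1 := by
    rw [hν, withDensity_apply _ MeasurableSet.univ, Measure.restrict_univ,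
      ← ofReal_integral_eq_lintegral_ofReal φ.integrable_normed
        (Eventually.of_forall φ.nonneg_normed), φ.integral_normed, ENNReal.ofReal_one]
  have : IsProbabilityMeasure ν := ⟨hν1⟩
  have hgm2 : Measurable fun q : E × E => ‖g (q.1 - q.2)‖ₑ :=
    hgm.enorm.comp (measurable_fst.sub measurable_snd)
  have hpt : ∀ x, ‖(φ.normed volume ⋆[ContinuousLinearMap.lsmul ℝ ℝ, volume] g) x‖ₑ ^ p ≤
      ∫⁻ y, ‖g (x - y)‖ₑ ^ p ∂ν := by
    intro x
    have hmx : Measurable fun y => ‖g (x - y)‖ₑ := hgm2.comp measurable_prodMk_left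
    have h1 : ‖(φ.normed volume ⋆[ContinuousLinearMap.lsmul ℝ ℝ, volume] g) x‖ₑ ≤
        ∫⁻ y, ‖g (x - y)‖ₑ ∂ν := by
      rw [hν, lintegral_withDensity_eq_lintegral_mul _ hρm hmx]
      refine (enorm_integral_le_lintegral_enorm _).trans (le_of_eq (lintegral_congr fun y => ?_))
      simp only [ContinuousLinearMap.lsmul_apply, enorm_smul, Pi.mul_apply, hρ]
      rw [Real.enorm_of_nonneg (φ.nonneg_normed y)]
    have h2 := lintegral_le_rpow_mul_rpow (μ := ν) hp hmx.aemeasurable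
    rw [hν1, ENNReal.one_rpow, mul_one, one_div] at h2
    exact (ENNReal.le_rpow_inv_iff hp0).1 (h1.trans h2)
  calc _ ≤ ∫⁻ x, ∫⁻ y, ‖g (x - y)‖ₑ ^ p ∂ν := lintegral_mono hpt
    _ = ∫⁻ y, (∫⁻ x, ‖g (x - y)‖ₑ ^ p) ∂ν :=
        lintegral_lintegral_swap (hgm2.pow_const p).aemeasurable
    _ = ∫⁻ y, (∫⁻ x, ‖g x‖ₑ ^ p) ∂ν :=
        lintegral_congr fun y => lintegral_sub_right_eq_self (fun x => ‖g x‖ₑ ^ p) y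
    _ = _ := by rw [lintegral_const, hν1, mul_one]

/-- A bump function supported in the closed ball of radius `2 / (k + 1)`. -/
noncomputable def shrinkingBump (E : Type*) [NormedAddCommGroup E] (k : ℕ) :
    ContDiffBump (0 : E) where
  rIn := 1 / (k + 1)
  rOut := 2 / (k + 1)
  rIn_pos := by positivity
  rIn_lt_rOut := by gcongr; norm_num

/-- The convolution of `g` with a normalised bump function. -/
noncomputable def mollify (k : ℕ) (g : E → G) : E → G :=
  (shrinkingBump E k).normed volume ⋆[ContinuousLinearMap.lsmul ℝ ℝ, volume] g

theorem tendsto_rOut_shrinkingBump (E : Type*) [NormedAddCommGroup E] :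
    Tendsto (fun k => (shrinkingBump E k).rOut) atTop (𝓝 0) := by
  have := tendsto_one_div_add_atTop_nhds_zero_nat (𝕜 := ℝ) |>.const_mul 2
  simpa [shrinkingBump, div_eq_mul_inv] using this

theorem contDiff_mollify (k : ℕ) {g : E → G} (hg : Integrable g) :
    ContDiff ℝ (⊤ : ℕ∞) (mollify k g) :=
  (shrinkingBump E k).hasCompactSupport_normed.contDiff_convolution_left _
    (shrinkingBump E k).contDiff_normed hg.locallyIntegrable

theorem ae_tendsto_mollify [CompleteSpace G] {g : E → G} (hg : Integrable g) :
    ∀ᵐ x, Tendsto (fun k => mollify k g x) atTop (𝓝 (g x)) := by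
  refine ContDiffBump.ae_convolution_tendsto_right_of_locallyIntegrable (K := 2)
    (tendsto_rOut_shrinkingBump E) (Eventually.of_forall fun k => ?_) hg.locallyIntegrable
  simp [shrinkingBump, div_eq_mul_inv]

theorem tendsto_lintegral_mollify_sub [CompleteSpace G] {g : E → G} (hg : Integrable g) :
    Tendsto (fun k => ∫⁻ x, ‖mollify k g x - g x‖ₑ) atTop (𝓝 0) := by
  refine tendsto_lintegral_enorm_sub_of_lintegral_le
    (fun k => (contDiff_mollify k hg).continuous.aestronglyMeasurable) hg.1
    (ae_tendsto_mollify hg) (fun k => ?_) hg.2.ne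
  simpa [mollify] using lintegral_enorm_convolution_rpow_le (shrinkingBump E k) hg.1 le_rfl

end Mollifier

/-- The derivative of the convolution falls on the bump. As t ↦ ρ(x - t) is supported in a ball
inside `B`, it is a test function, and the defining identity of the weak differential moves the
derivative onto `u`; the cut-off by `B` is invisible there. -/
theorem HasWeakFDeriv.fderiv_mollify {n : ℕ} {U : Set (EuclideanSpace ℝ (Fin n))}
    (hU : IsOpen U) {u : EuclideanSpace ℝ (Fin n) → ℝ}
    {Du : EuclideanSpace ℝ (Fin n) → EuclideanSpace ℝ (Fin n) →L[ℝ] ℝ}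
    (h : HasWeakFDeriv U u Du) {B : Set (EuclideanSpace ℝ (Fin n))} (hB : MeasurableSet B)
    (hBU : B ⊆ U) (hu : IntegrableOn u B) (hDu : IntegrableOn Du B) {k : ℕ}
    {x : EuclideanSpace ℝ (Fin n)} (hx : closedBall x (shrinkingBump (EuclideanSpace ℝ (Fin n)) k).rOut ⊆ B) :
    fderiv ℝ (mollify k (B.indicator u)) x = mollify k (B.indicator Du) x := by
  set φ := shrinkingBump (EuclideanSpace ℝ (Fin n)) k with hφ
  set ρ := φ.normed volume with hρ
  have hui : Integrable (B.indicator u) := hu.integrable_indicator hB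
  have hDui : Integrable (B.indicator Du) := 
    integrable_indicator_of_integrableOn hDu hB
  have hρs : ContDiff ℝ (⊤ : ℕ∞) ρ := φ.contDiff_normed
  have hρ1 : ContDiff ℝ 1 ρ := φ.contDiff_normed
  have hρd : Differentiable ℝ ρ := hρ1.differentiable one_ne_zero
  have hρc : HasCompactSupport ρ := φ.hasCompactSupport_normed
  have hder := hρc.hasFDerivAt_convolution_left (ContinuousLinearMap.lsmul ℝ ℝ) (μ := volume)
    hρ1 hui.locallyIntegrable x
  have hfd : fderiv ℝ (mollify k (B.indicator u)) x = _ := hder.fderiv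
  rw [hfd]
  set ψ : EuclideanSpace ℝ (Fin n) → ℝ := fun t => ρ (x - t) with hψ
  have hψts : tsupport ψ ⊆ closedBall x φ.rOut := by
    refine closure_minimal (fun t ht => ?_) isClosed_closedBall
    have : x - t ∈ Function.support ρ := ht
    rw [φ.support_normed_eq, mem_ball_zero_iff] at this
    rw [mem_closedBall, dist_comm, dist_eq_norm]
    exact this.le
  have hψfd : ∀ t v, fderiv ℝ ψ t v = - fderiv ℝ ρ (x - t) v := fun t v => by
    have h1 : HasFDerivAt ψ ((fderiv ℝ ρ (x - t)).comp
        (-ContinuousLinearMap.id ℝ (EuclideanSpace ℝ (Fin n)))) t :=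
      (hρd (x - t)).hasFDerivAt.comp t ((hasFDerivAt_id t).const_sub x)
    rw [h1.fderiv]
    simp
  have hψtest : IsTestFunction U ψ :=
    ⟨hρs.comp (contDiff_const.sub contDiff_id),
      HasCompactSupport.of_support_subset_isCompact (isCompact_closedBall x φ.rOut)
        ((subset_tsupport ψ).trans hψts), (hψts.trans hx).trans hBU⟩
  have hψ0 : ∀ t, t ∉ B → ψ t = 0 := fun t ht =>
    image_eq_zero_of_notMem_tsupport fun h' => ht (hx (hψts h'))
  have hψ0' : ∀ t, t ∉ B → fderiv ℝ ψ t = 0 := fun t ht =>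
    image_eq_zero_of_notMem_tsupport fun h' => ht (hx (hψts (tsupport_fderiv_subset ℝ h')))
  have hce : ConvolutionExistsAt (fderiv ℝ ρ) (B.indicator u) x
      ((ContinuousLinearMap.lsmul ℝ ℝ).precompL (EuclideanSpace ℝ (Fin n))) volume :=
    (hρc.fderiv ℝ).convolutionExists_left _ (hρ1.continuous_fderiv one_ne_zero)
      hui.locallyIntegrable x
  have hce' : ConvolutionExistsAt ρ (B.indicator Du) x (ContinuousLinearMap.lsmul ℝ ℝ) volume :=
    hρc.convolutionExists_left _ hρ1.continuous hDui.locallyIntegrable x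
  ext v
  have hL : ((fderiv ℝ ρ ⋆[(ContinuousLinearMap.lsmul ℝ ℝ).precompL
      (EuclideanSpace ℝ (Fin n)), volume] B.indicator u) x) v =
      - ∫ t in U, fderiv ℝ ψ t v • u t := by
    rw [convolution_eq_swap, ContinuousLinearMap.integral_apply hce.integrable_swap,
      ← integral_indicator hU.measurableSet, ← integral_neg]
    refine integral_congr_ae (Eventually.of_forall fun t => ?_)
    by_cases ht : t ∈ B
    · simp [ht, hBU ht, hψfd]
    · by_cases htU : t ∈ U <;> simp [ht, htU, hψ0' t ht]
  have hR : (mollify k (B.indicator Du) x) v = ∫ t in U, ψ t • Du t v := by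
    rw [mollify, convolution_eq_swap, ContinuousLinearMap.integral_apply hce'.integrable_swap,
      ← integral_indicator hU.measurableSet]
    refine integral_congr_ae (Eventually.of_forall fun t => ?_)
    by_cases ht : t ∈ B
    · simp [ht, hBU ht, hψ, hρ, hφ]
    · by_cases htU : t ∈ U <;> simp [ht, htU, hψ0 t ht]
  rw [hR, hL, h.integral_eq ψ hψtest v, neg_neg]

/-- Local approximation of Sobolev functions by smooth functions. -/
theorem HasWeakFDeriv.exists_smooth_approx {n : ℕ} {U : Set (EuclideanSpace ℝ (Fin n))}
    (hU : IsOpen U) {u : EuclideanSpace ℝ (Fin n) → ℝ}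
    {Du : EuclideanSpace ℝ (Fin n) → EuclideanSpace ℝ (Fin n) →L[ℝ] ℝ}
    (h : HasWeakFDeriv U u Du) {z : EuclideanSpace ℝ (Fin n)} {R R' : ℝ} (hRR' : R < R')
    (hz : closedBall z R' ⊆ U) :
    ∃ w : ℕ → EuclideanSpace ℝ (Fin n) → ℝ,
      (∀ k, ContDiff ℝ (⊤ : ℕ∞) (w k)) ∧
      (∀ᵐ x ∂(volume.restrict (ball z R)), Tendsto (fun k => w k x) atTop (𝓝 (u x))) ∧
      Tendsto (fun k => ∫⁻ x in ball z R, ‖w k x - u x‖ₑ) atTop (𝓝 0) ∧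
      Tendsto (fun k => ∫⁻ x in ball z R, ‖fderiv ℝ (w k) x - Du x‖ₑ) atTop (𝓝 0) ∧
      ∀ p : ℝ, 1 ≤ p → ∀ k, ∫⁻ x in ball z R, ‖fderiv ℝ (w k) x‖ₑ ^ p ≤
        ∫⁻ x in ball z R', ‖Du x‖ₑ ^ p := by
  set B := ball z R' with hB
  have hBm : MeasurableSet B := measurableSet_ball
  have hBU : B ⊆ U := ball_subset_closedBall.trans hz
  have hu : IntegrableOn u B := (h.locallyIntegrable.integrableOn_compact_subset hz
    (isCompact_closedBall z R')).mono_set ball_subset_closedBall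
  have hDu : IntegrableOn Du B := (h.locallyIntegrable_deriv.integrableOn_compact_subset hz
    (isCompact_closedBall z R')).mono_set ball_subset_closedBall
  have hui : Integrable (B.indicator u) := hu.integrable_indicator hBm
  have hDui : Integrable (B.indicator Du) := 
    integrable_indicator_of_integrableOn hDu hBm
  -- Shifting the index makes all bump radii smaller than R' - R, so that mollification at points of
  -- the smaller ball only sees the larger one.
  obtain ⟨k₀, hk₀⟩ : ∃ k₀, ∀ k ≥ k₀,
      (shrinkingBump (EuclideanSpace ℝ (Fin n)) k).rOut < R' - R :=
    eventually_atTop.1 ((tendsto_rOut_shrinkingBump _).eventually_lt_const (sub_pos.2 hRR'))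
  have hsub : ball z R ⊆ B := ball_subset_ball hRR'.le
  have hfd : ∀ k, ∀ x ∈ ball z R, fderiv ℝ (mollify (k + k₀) (B.indicator u)) x =
      mollify (k + k₀) (B.indicator Du) x := fun k x hx =>
    h.fderiv_mollify hU hBm hBU hu hDu ((closedBall_subset_ball' (by
      rw [mem_ball] at hx
      linarith [hk₀ (k + k₀) (by omega)])))
  have hle : ∀ F : EuclideanSpace ℝ (Fin n) → ℝ≥0∞, ∫⁻ x in ball z R, F x ≤ ∫⁻ x, F x :=
    fun F => lintegral_mono' Measure.restrict_le_self le_rfl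
  have hind : ∀ x ∈ ball z R, B.indicator u x = u x := fun x hx => indicator_of_mem (hsub hx) _
  have hindD : ∀ x ∈ ball z R, B.indicator Du x = Du x := fun x hx => indicator_of_mem (hsub hx) _
  refine ⟨fun k => mollify (k + k₀) (B.indicator u), fun k => contDiff_mollify _ hui, ?_, ?_, ?_,
    fun p hp k => ?_⟩
  · filter_upwards [ae_restrict_of_ae (ae_tendsto_mollify hui), ae_restrict_mem measurableSet_ball]
      with x hx hxB
    rw [hind x hxB] at hx
    exact (tendsto_add_atTop_iff_nat k₀).2 hx
  · refine tendsto_of_tendsto_of_tendsto_of_le_of_le tendsto_const_nhds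
      ((tendsto_add_atTop_iff_nat k₀).2 (tendsto_lintegral_mollify_sub hui))
      (fun k => zero_le) fun k => ?_
    refine le_trans (le_of_eq ?_) (hle _)
    exact setLIntegral_congr_fun measurableSet_ball fun x hx => by simp only [hind x hx]
  · refine tendsto_of_tendsto_of_tendsto_of_le_of_le tendsto_const_nhds
      ((tendsto_add_atTop_iff_nat k₀).2 (tendsto_lintegral_mollify_sub hDui))
      (fun k => zero_le) fun k => ?_
    refine le_trans (le_of_eq ?_) (hle _)
    exact setLIntegral_congr_fun measurableSet_ball fun x hx => by
      simp only [hindD x hx, hfd k x hx]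
  · calc _ = ∫⁻ x in ball z R, ‖mollify (k + k₀) (B.indicator Du) x‖ₑ ^ p :=
          setLIntegral_congr_fun measurableSet_ball fun x hx => by simp only [hfd k x hx]
      _ ≤ ∫⁻ x, ‖B.indicator Du x‖ₑ ^ p :=
          (hle _).trans (lintegral_enorm_convolution_rpow_le _ hDui.1 hp)
      _ = ∫⁻ x in B, ‖Du x‖ₑ ^ p := lintegral_enorm_indicator_rpow _ hBm (by linarith)

/-! ### Smooth truncations and membership in W^{1,1}_0 -/

/-- A smooth approximation of the function `y ↦ 2 * max y 0`. -/
theorem exists_smooth_posPart : ∃ (P : ℝ → ℝ) (M : ℝ), ContDiff ℝ (⊤ : ℕ∞) P ∧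
    (∀ y ≤ 0, P y = 0) ∧ (∀ y, |P y - (y + |y|)| ≤ 2) ∧ (∀ y, |deriv P y| ≤ M) ∧
    (∀ y < 0, deriv P y = 0) ∧ ∀ y > 1, deriv P y = 2 := by
  set P : ℝ → ℝ := fun y => 2 * y * Real.smoothTransition y with hP
  have hPs : ContDiff ℝ (⊤ : ℕ∞) P :=
    (contDiff_const.mul contDiff_id).mul Real.smoothTransition.contDiff
  have hneg : ∀ y < 0, deriv P y = 0 := fun y hy => by
    have : P =ᶠ[𝓝 y] fun _ => 0 := by
      filter_upwards [eventually_lt_nhds hy] with x hx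
      simp [hP, Real.smoothTransition.zero_of_nonpos hx.le]
    rw [this.deriv_eq]; simp
  have hbig : ∀ y > 1, deriv P y = 2 := fun y hy => by
    have : P =ᶠ[𝓝 y] fun x => 2 * x := by
      filter_upwards [eventually_gt_nhds hy] with x hx
      simp [hP, Real.smoothTransition.one_of_one_le (le_of_lt hx)]
    rw [this.deriv_eq, deriv_const_mul _ differentiableAt_id]; simp
  have hcont : Continuous (deriv P) := hPs.continuous_deriv (by simp)
  obtain ⟨M, hM⟩ := (isCompact_Icc (a := (0 : ℝ)) (b := 1)).exists_bound_of_continuousOn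
    hcont.continuousOn
  refine ⟨P, max M 2, hPs, fun y hy => ?_, fun y => ?_, fun y => ?_, hneg, hbig⟩
  · simp [hP, Real.smoothTransition.zero_of_nonpos hy]
  · rcases le_or_gt y 0 with h | h
    · simp [hP, Real.smoothTransition.zero_of_nonpos h, abs_of_nonpos h]
    · rcases le_or_gt 1 y with h1 | h1
      · simp only [hP, Real.smoothTransition.one_of_one_le h1, abs_of_pos h]
        ring_nf; norm_num
      · have h2 := Real.smoothTransition.nonneg y
        have h3 := Real.smoothTransition.le_one y
        simp only [hP, abs_of_pos h]
        rw [abs_le]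
        constructor <;> nlinarith
  · rcases lt_or_ge y 0 with h | h
    · simp [hneg y h]
    · rcases lt_or_ge 1 y with h1 | h1
      · simp [hbig y h1]
      · exact (hM y ⟨h, h1⟩).trans (le_max_left _ _)

/-- Smooth approximations of `x ↦ |b - x| - |x - a| + 2 * x - a - b` that vanish on `[a, b]`. -/
theorem exists_smooth_truncation {a b : ℝ} (hab : a ≤ b) : ∃ (T : ℕ → ℝ → ℝ) (M : ℝ),
    (∀ k, ContDiff ℝ (⊤ : ℕ∞) (T k)) ∧ (∀ k, ∀ x ∈ Icc a b, T k x = 0) ∧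
    (∀ k x, |deriv (T k) x| ≤ M) ∧
    (∀ (k : ℕ) x, |T k x - (|b - x| - |x - a| + 2 * x - a - b)| ≤ 4 / (k + 1)) ∧
    ∀ (y : ℕ → ℝ) (x : ℝ), x ≠ a → x ≠ b → Tendsto y atTop (𝓝 x) →
      Tendsto (fun k => deriv (T k) (y k)) atTop (𝓝 (if x < a ∨ b < x then 2 else 0)) := by
  obtain ⟨P, M, hPs, hP0, hPd, hPM, hPneg, hPbig⟩ := exists_smooth_posPart
  have hk : ∀ k : ℕ, (0 : ℝ) < k + 1 := fun k => by positivity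
  -- The target function equals 2(x - b)⁺ - 2(a - x)⁺, and `P` is a smooth version of 2y⁺ rescaled
  -- by k + 1. Since `P` vanishes exactly for y ≤ 0, so does `T k` on all of [a, b]; the error 4/(k
  -- + 1) comes from two errors of 2.
  set T : ℕ → ℝ → ℝ := fun k x => (P ((k + 1) * (x - b)) - P ((k + 1) * (a - x))) / (k + 1) with hT
  have hTd : ∀ k x, deriv (T k) x = deriv P ((k + 1) * (x - b)) + deriv P ((k + 1) * (a - x)) := by
    intro k x
    have hPd : Differentiable ℝ P := hPs.differentiable (by simp)
    have h1 : HasDerivAt (fun x : ℝ => ((k : ℝ) + 1) * (x - b)) ((k + 1) * 1) x :=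
      ((hasDerivAt_id x).sub_const b).const_mul _
    have h2 : HasDerivAt (fun x : ℝ => ((k : ℝ) + 1) * (a - x)) ((k + 1) * (-1)) x :=
      ((hasDerivAt_id x).const_sub a).const_mul _
    have h3 := (((hPd _).hasDerivAt.comp x h1).sub ((hPd _).hasDerivAt.comp x h2)).div_const
      ((k : ℝ) + 1)
    refine h3.deriv.trans ?_
    have := (hk k).ne'
    field_simp
    ring
  refine ⟨T, M + M, fun k => ?_, fun k x hx => ?_, fun k x => ?_, fun k x => ?_, ?_⟩
  · exact ((hPs.comp (contDiff_const.mul (contDiff_id.sub contDiff_const))).sub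
      (hPs.comp (contDiff_const.mul (contDiff_const.sub contDiff_id)))).div_const _
  · have h1 := hP0 ((k + 1) * (x - b))
      (mul_nonpos_of_nonneg_of_nonpos (hk k).le (by linarith [hx.2]))
    have h2 := hP0 ((k + 1) * (a - x))
      (mul_nonpos_of_nonneg_of_nonpos (hk k).le (by linarith [hx.1]))
    simp [hT, h1, h2]
  · rw [hTd]
    exact (abs_add_le _ _).trans (add_le_add (hPM _) (hPM _))
  · have h1 := hPd ((k + 1) * (x - b))
    have h2 := hPd ((k + 1) * (a - x))
    rw [abs_mul, abs_of_pos (hk k)] at h1 h2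
    have e : T k x - (|b - x| - |x - a| + 2 * x - a - b) =
        ((P ((k + 1) * (x - b)) - ((k + 1) * (x - b) + (k + 1) * |x - b|)) -
          (P ((k + 1) * (a - x)) - ((k + 1) * (a - x) + (k + 1) * |a - x|))) / (k + 1) := by
      rw [abs_sub_comm b x, abs_sub_comm x a]
      have := (hk k).ne'
      simp only [hT]
      field_simp
      ring
    rw [e, abs_div, abs_of_pos (hk k)]
    gcongr
    refine (abs_sub _ _).trans ?_
    linarith
  · intro y x hxa hxb hy
    simp only [hTd]
    have hbig : ∀ {q : ℕ → ℝ} {c : ℝ}, 0 < c → Tendsto q atTop (𝓝 c) →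
        Tendsto (fun k : ℕ => deriv P ((k + 1) * q k)) atTop (𝓝 2) := by
      intro q c hc hq
      have h1 : Tendsto (fun k : ℕ => ((k : ℝ) + 1) * q k) atTop atTop :=
        (tendsto_natCast_atTop_atTop.atTop_add tendsto_const_nhds).atTop_mul_pos hc hq
      refine tendsto_const_nhds.congr' ?_
      filter_upwards [h1.eventually_gt_atTop 1] with k hk1
      rw [hPbig _ hk1]
    have hsmall : ∀ {q : ℕ → ℝ} {c : ℝ}, c < 0 → Tendsto q atTop (𝓝 c) →
        Tendsto (fun k : ℕ => deriv P ((k + 1) * q k)) atTop (𝓝 0) := by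
      intro q c hc hq
      refine tendsto_const_nhds.congr' ?_
      filter_upwards [hq.eventually_lt_const hc] with k hk1
      rw [hPneg _ (mul_neg_of_pos_of_neg (hk k) hk1)]
    have hyb : Tendsto (fun k => y k - b) atTop (𝓝 (x - b)) := hy.sub_const b
    have hya : Tendsto (fun k => a - y k) atTop (𝓝 (a - x)) := hy.const_sub a
    rcases lt_or_gt_of_ne hxa with h | h
    · have := (hsmall (by linarith : x - b < 0) hyb).add (hbig (by linarith : 0 < a - x) hya)
      simpa [h] using this
    · rcases lt_or_gt_of_ne hxb with h' | h'
      · have := (hsmall (by linarith : x - b < 0) hyb).add (hsmall (by linarith : a - x < 0) hya)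
        simpa [not_lt.2 h.le, not_lt.2 h'.le] using this
      · have := (hbig (by linarith : 0 < x - b) hyb).add (hsmall (by linarith : a - x < 0) hya)
        simpa [h'] using this

/-- Weak differentiability is stable under convergence in `W^{1,1}`. -/
theorem hasWeakFDeriv_of_tendsto {n : ℕ} {B : Set (EuclideanSpace ℝ (Fin n))}
    {v : EuclideanSpace ℝ (Fin n) → ℝ}
    {V : EuclideanSpace ℝ (Fin n) → EuclideanSpace ℝ (Fin n) →L[ℝ] ℝ}
    (hv : IntegrableOn v B) (hV : IntegrableOn V B) {g : ℕ → EuclideanSpace ℝ (Fin n) → ℝ}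
    (hg : ∀ k, ContDiff ℝ 1 (g k))
    (hgv : Tendsto (fun k => ∫⁻ x in B, ‖g k x - v x‖ₑ) atTop (𝓝 0))
    (hgV : Tendsto (fun k => ∫⁻ x in B, ‖fderiv ℝ (g k) x - V x‖ₑ) atTop (𝓝 0)) :
    HasWeakFDeriv B v V := by
  refine ⟨hv.locallyIntegrableOn, hV.locallyIntegrableOn, fun φ hφ e => ?_⟩
  have hφ1 : ContDiff ℝ 1 φ := hφ.smooth.of_le (by exact_mod_cast le_top)
  have hφd : Continuous fun x => fderiv ℝ φ x e :=
    (hφ1.continuous_fderiv one_ne_zero).clm_apply continuous_const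
  have hφdc : HasCompactSupport fun x => fderiv ℝ φ x e :=
    (hφ.compact.fderiv ℝ).comp_left (g := fun L : EuclideanSpace ℝ (Fin n) →L[ℝ] ℝ => L e) rfl
  obtain ⟨C₁, hC₁⟩ := hφdc.exists_bound_of_continuous hφd
  obtain ⟨C₂, hC₂⟩ := hφ.compact.exists_bound_of_continuous hφ1.continuous
  have hgd : ∀ k, Continuous fun x => fderiv ℝ (g k) x e := fun k =>
    ((hg k).continuous_fderiv one_ne_zero).clm_apply continuous_const
  have hi1 : ∀ k, Integrable fun x => fderiv ℝ φ x e • g k x := fun k =>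
    (hφd.smul (hg k).continuous).integrable_of_hasCompactSupport hφdc.smul_right
  have hi2 : ∀ k, Integrable fun x => φ x • fderiv ℝ (g k) x e := fun k =>
    (hφ1.continuous.smul (hgd k)).integrable_of_hasCompactSupport hφ.compact.smul_right
  have hi3 : ∀ k, Integrable fun x => φ x • g k x := fun k =>
    (hφ1.continuous.smul (hg k).continuous).integrable_of_hasCompactSupport hφ.compact.smul_right
  have hparts : ∀ k, ∫ x in B, fderiv ℝ φ x e • g k x = - ∫ x in B, φ x • fderiv ℝ (g k) x e := by
    intro k
    have h := integral_smul_fderiv_eq_neg_fderiv_smul_of_integrable (hi1 k) (hi2 k) (hi3 k)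
      (fun x _ => (hφ1.differentiable one_ne_zero) x)
      (fun x _ => ((hg k).differentiable one_ne_zero) x)
    have h1 : ∫ x in B, fderiv ℝ φ x e • g k x = ∫ x, fderiv ℝ φ x e • g k x :=
      setIntegral_eq_integral_of_forall_compl_eq_zero fun x hx => by
        rw [image_eq_zero_of_notMem_tsupport (f := fderiv ℝ φ) fun h' =>
          hx (hφ.support_subset (tsupport_fderiv_subset ℝ h'))]
        simp
    have h2 : ∫ x in B, φ x • fderiv ℝ (g k) x e = ∫ x, φ x • fderiv ℝ (g k) x e :=
      setIntegral_eq_integral_of_forall_compl_eq_zero fun x hx => by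
        rw [image_eq_zero_of_notMem_tsupport (f := φ) fun h' => hx (hφ.support_subset h'), zero_smul]
    rw [h1, h2, h, neg_neg]
  have hlim1 : Tendsto (fun k => ∫ x in B, fderiv ℝ φ x e • g k x) atTop
      (𝓝 (∫ x in B, fderiv ℝ φ x e • v x)) := by
    refine tendsto_integral_of_L1 _
      (hv.bdd_mul hφd.aestronglyMeasurable (Eventually.of_forall hC₁)).1
      (Eventually.of_forall fun k => (hi1 k).integrableOn) ?_
    have hz := ENNReal.Tendsto.const_mul hgv (a := ENNReal.ofReal C₁) (Or.inr ENNReal.ofReal_ne_top)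
    rw [mul_zero] at hz
    refine tendsto_of_tendsto_of_tendsto_of_le_of_le tendsto_const_nhds hz (fun _ => zero_le)
      fun k => ?_
    rw [← lintegral_const_mul' _ _ ENNReal.ofReal_ne_top]
    refine lintegral_mono fun x => ?_
    rw [smul_eq_mul, ← mul_sub, enorm_mul]
    gcongr
    rw [← ofReal_norm]
    exact ENNReal.ofReal_le_ofReal (hC₁ x)
  have hlim2 : Tendsto (fun k => ∫ x in B, φ x • fderiv ℝ (g k) x e) atTop
      (𝓝 (∫ x in B, φ x • V x e)) := by
    have hVe : IntegrableOn (fun x => V x e) B := hV.apply_continuousLinearMap e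
    refine tendsto_integral_of_L1 _
      (hVe.bdd_mul hφ1.continuous.aestronglyMeasurable (Eventually.of_forall hC₂)).1
      (Eventually.of_forall fun k => (hi2 k).integrableOn) ?_
    have hz := ENNReal.Tendsto.const_mul hgV (a := ENNReal.ofReal C₂ * ‖e‖ₑ)
      (Or.inr (ENNReal.mul_ne_top ENNReal.ofReal_ne_top (by simp)))
    rw [mul_zero] at hz
    refine tendsto_of_tendsto_of_tendsto_of_le_of_le tendsto_const_nhds hz (fun _ => zero_le)
      fun k => ?_
    rw [← lintegral_const_mul' _ _ (ENNReal.mul_ne_top ENNReal.ofReal_ne_top (by simp))]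
    refine lintegral_mono fun x => ?_
    rw [smul_eq_mul, ← mul_sub, enorm_mul, ← sub_apply, mul_assoc]
    gcongr
    · rw [← ofReal_norm]
      exact ENNReal.ofReal_le_ofReal (hC₂ x)
    · rw [mul_comm]
      exact ContinuousLinearMap.le_opENorm _ _
  refine tendsto_nhds_unique hlim1 ?_
  simp only [hparts]
  exact hlim2.neg

/-- A smooth function which vanishes near the boundary sphere of a ball, cut off outside the ball,
is a test function. -/
theorem isTestFunction_indicator_ball {n : ℕ} {z : EuclideanSpace ℝ (Fin n)} {t : ℝ}
    {g : EuclideanSpace ℝ (Fin n) → ℝ} (hg : ContDiff ℝ (⊤ : ℕ∞) g)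
    {O : Set (EuclideanSpace ℝ (Fin n))} (hO : IsOpen O) (hsub : sphere z t ⊆ O)
    (hg0 : ∀ x ∈ O, g x = 0) : IsTestFunction (ball z t) ((ball z t).indicator g) := by
  set K := closedBall z t \ O with hK
  have hKc : IsCompact K := (isCompact_closedBall z t).diff hO
  have hKb : K ⊆ ball z t := fun x hx => by
    rcases (mem_closedBall.1 hx.1).lt_or_eq with h | h
    · exact h
    · exact absurd (hsub h) hx.2
  have hsupp : Function.support ((ball z t).indicator g) ⊆ K := fun x hx => by
    have hxb : x ∈ ball z t := by
      by_contra h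
      exact hx (indicator_of_notMem h _)
    refine ⟨ball_subset_closedBall hxb, fun hxO => hx ?_⟩
    rw [indicator_of_mem hxb, hg0 x hxO]
  refine ⟨contDiff_iff_contDiffAt.2 fun x => ?_,
    HasCompactSupport.of_support_subset_isCompact hKc hsupp,
    (closure_minimal hsupp hKc.isClosed).trans hKb⟩
  by_cases hx : x ∈ ball z t
  · refine hg.contDiffAt.congr_of_eventuallyEq ?_
    filter_upwards [isOpen_ball.mem_nhds hx] with y hy
    exact indicator_of_mem hy _
  · refine (contDiffAt_const (c := (0 : ℝ))).congr_of_eventuallyEq ?_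
    filter_upwards [hKc.isClosed.isOpen_compl.mem_nhds fun h => hx (hKb h)] with y hy
    exact Function.notMem_support.1 fun h => hy (hsupp h)

section Truncation

variable {α : Type*} [MeasurableSpace α] {μ : Measure α}

/-- The functions `T k` are uniformly `M`-Lipschitz and uniformly close to `S`, and the measure is
finite. -/
theorem tendsto_lintegral_truncation [IsFiniteMeasure μ] {S : ℝ → ℝ} {T : ℕ → ℝ → ℝ} {M : ℝ}
    (hT : ∀ k, Differentiable ℝ (T k)) (hM : ∀ k x, |deriv (T k) x| ≤ M)
    (hTS : ∀ (k : ℕ) x, |T k x - S x| ≤ 4 / (k + 1)) {u : α → ℝ} {w : ℕ → α → ℝ}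
    (hw : Tendsto (fun k => ∫⁻ x, ‖w k x - u x‖ₑ ∂μ) atTop (𝓝 0)) :
    Tendsto (fun k => ∫⁻ x, ‖T k (w k x) - S (u x)‖ₑ ∂μ) atTop (𝓝 0) := by
  have hbound : ∀ k x, ‖T k (w k x) - S (u x)‖ₑ ≤
      ENNReal.ofReal M * ‖w k x - u x‖ₑ + ENNReal.ofReal (4 / (k + 1)) := by
    intro k x
    have h1 : ‖T k (w k x) - T k (u x)‖ ≤ M * ‖w k x - u x‖ :=
      convex_univ.norm_image_sub_le_of_norm_deriv_le (fun y _ => hT k y) (fun y _ => hM k y)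
        (mem_univ _) (mem_univ _)
    have hM0 : 0 ≤ M := (abs_nonneg _).trans (hM 0 0)
    have h2 : ‖T k (w k x) - S (u x)‖ ≤ M * ‖w k x - u x‖ + 4 / (k + 1) :=
      (norm_sub_le_norm_sub_add_norm_sub _ (T k (u x)) _).trans (add_le_add h1 (hTS k (u x)))
    rw [← ofReal_norm, ← ofReal_norm (w k x - u x), ← ENNReal.ofReal_mul hM0,
      ← ENNReal.ofReal_add (by positivity) (by positivity)]
    exact ENNReal.ofReal_le_ofReal h2
  have h4 : Tendsto (fun k : ℕ => (4 : ℝ) / (k + 1)) atTop (𝓝 0) := by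
    have := tendsto_one_div_add_atTop_nhds_zero_nat (𝕜 := ℝ) |>.const_mul 4
    simpa [div_eq_mul_inv] using this
  have hz := (ENNReal.Tendsto.const_mul hw (a := ENNReal.ofReal M)
    (Or.inr ENNReal.ofReal_ne_top)).add (ENNReal.Tendsto.mul_const (ENNReal.tendsto_ofReal h4)
      (b := μ univ) (Or.inr (measure_ne_top _ _)))
  rw [mul_zero, ENNReal.ofReal_zero, zero_mul, add_zero] at hz
  refine tendsto_of_tendsto_of_tendsto_of_le_of_le tendsto_const_nhds hz (fun _ => zero_le)
    fun k => (lintegral_mono (hbound k)).trans ?_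
  rw [lintegral_add_right _ measurable_const, lintegral_const,
    lintegral_const_mul' _ _ ENNReal.ofReal_ne_top]

/-- Serves the chain rule in the limit. In c_k (D_k - D_0) + (c_k - c_0) D_0 the first term is small
in L¹ by boundedness, the second by dominated convergence. -/
theorem tendsto_lintegral_smul_sub_smul {G : Type*} [NormedAddCommGroup G] [NormedSpace ℝ G]
    {c : ℕ → α → ℝ} {c₀ : α → ℝ} {M : ℝ} (hcm : ∀ k, AEStronglyMeasurable (c k) μ)
    (hM : ∀ k x, |c k x| ≤ M) (hM₀ : ∀ x, |c₀ x| ≤ M)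
    (hlim : ∀ᵐ x ∂μ, Tendsto (fun k => c k x) atTop (𝓝 (c₀ x))) {D : ℕ → α → G} {D₀ : α → G}
    (hD₀ : Integrable D₀ μ) (hD : Tendsto (fun k => ∫⁻ x, ‖D k x - D₀ x‖ₑ ∂μ) atTop (𝓝 0)) :
    Tendsto (fun k => ∫⁻ x, ‖c k x • D k x - c₀ x • D₀ x‖ₑ ∂μ) atTop (𝓝 0) := by
  have hc₀m : AEStronglyMeasurable c₀ μ := aestronglyMeasurable_of_tendsto_ae _ hcm hlim
  have hbound : ∀ k x, ‖c k x • D k x - c₀ x • D₀ x‖ₑ ≤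
      ENNReal.ofReal M * ‖D k x - D₀ x‖ₑ + ‖(c k x - c₀ x) • D₀ x‖ₑ := by
    intro k x
    rw [show c k x • D k x - c₀ x • D₀ x = c k x • (D k x - D₀ x) + (c k x - c₀ x) • D₀ x by module]
    refine (enorm_add_le _ _).trans ?_
    gcongr
    rw [enorm_smul, ← ofReal_norm (c k x)]
    gcongr
    exact hM k x
  have hdct : Tendsto (fun k => ∫⁻ x, ‖(c k x - c₀ x) • D₀ x‖ₑ ∂μ) atTop (𝓝 0) := by
    have key := tendsto_lintegral_of_dominated_convergence' (μ := μ)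
      (F := fun k x => ‖(c k x - c₀ x) • D₀ x‖ₑ) (f := fun _ => 0)
      (fun x => ENNReal.ofReal (2 * M) * ‖D₀ x‖ₑ)
      (fun k => (((hcm k).sub hc₀m).smul hD₀.1).enorm) (fun k => Eventually.of_forall fun x => ?_)
      ?_ ?_
    · simpa using key
    · simp only [enorm_smul]
      gcongr
      rw [← ofReal_norm]
      refine ENNReal.ofReal_le_ofReal ((norm_sub_le _ _).trans ?_)
      rw [two_mul]
      exact add_le_add (hM k x) (hM₀ x)
    · rw [lintegral_const_mul' _ _ ENNReal.ofReal_ne_top]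
      exact ENNReal.mul_ne_top ENNReal.ofReal_ne_top hD₀.2.ne
    · filter_upwards [hlim] with x hx
      have := ((hx.sub_const (c₀ x)).smul_const (D₀ x)).enorm
      simpa using this
  have hz := (ENNReal.Tendsto.const_mul hD (a := ENNReal.ofReal M)
    (Or.inr ENNReal.ofReal_ne_top)).add hdct
  rw [mul_zero, add_zero] at hz
  refine tendsto_of_tendsto_of_tendsto_of_le_of_le tendsto_const_nhds hz (fun _ => zero_le)
    fun k => (lintegral_mono (hbound k)).trans (le_of_eq ?_)
  have hm : AEMeasurable (fun x => ‖(c k x - c₀ x) • D₀ x‖ₑ) μ :=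
    (((hcm k).sub hc₀m).smul hD₀.1).enorm
  rw [lintegral_add_right' _ hm,
    lintegral_const_mul' _ _ ENNReal.ofReal_ne_top]

end Truncation

/-- If smooth approximations of `u` take values in `(a, b)` on the sphere `∂B`, then the truncation
of `u` at the levels `a` and `b` belongs to `W^{1,1}_0(B)`. -/
theorem memW11Zero_truncation {n : ℕ} {z : EuclideanSpace ℝ (Fin n)} {t : ℝ}
    {u : EuclideanSpace ℝ (Fin n) → ℝ}
    {Du : EuclideanSpace ℝ (Fin n) → EuclideanSpace ℝ (Fin n) →L[ℝ] ℝ}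
    (hu : IntegrableOn u (ball z t)) (hDu : IntegrableOn Du (ball z t))
    {w : ℕ → EuclideanSpace ℝ (Fin n) → ℝ} (hw : ∀ k, ContDiff ℝ (⊤ : ℕ∞) (w k))
    (hlim : ∀ᵐ x ∂(volume.restrict (ball z t)), Tendsto (fun k => w k x) atTop (𝓝 (u x)))
    (hwu : Tendsto (fun k => ∫⁻ x in ball z t, ‖w k x - u x‖ₑ) atTop (𝓝 0))
    (hwD : Tendsto (fun k => ∫⁻ x in ball z t, ‖fderiv ℝ (w k) x - Du x‖ₑ) atTop (𝓝 0))
    {a b : ℝ} (hab : a ≤ b) (ha : ∀ᵐ x ∂(volume.restrict (ball z t)), u x ≠ a)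
    (hb : ∀ᵐ x ∂(volume.restrict (ball z t)), u x ≠ b)
    (hsphere : ∃ᶠ k in atTop, ∀ x ∈ sphere z t, w k x ∈ Ioo a b) :
    MemW11Zero (ball z t) (fun x => |b - u x| - |u x - a| + 2 * u x - a - b) := by
  obtain ⟨T, M, hTs, hT0, hTM, hTS, hTlim⟩ := exists_smooth_truncation hab
  have hfin : IsFiniteMeasure (volume.restrict (ball z t)) :=
    ⟨by rw [Measure.restrict_apply_univ]; exact measure_ball_lt_top⟩
  have hTd : ∀ k, Differentiable ℝ (T k) := fun k => (hTs k).differentiable (by simp)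
  have hTwu := tendsto_lintegral_truncation (μ := volume.restrict (ball z t))
    (S := fun x => |b - x| - |x - a| + 2 * x - a - b) hTd hTM hTS hwu
  -- The derivative of the truncation at `u`. The levels `a` and `b` are attained only on null sets,
  -- so the corners of the truncation play no role.
  set c₀ : EuclideanSpace ℝ (Fin n) → ℝ := fun x => if u x < a ∨ b < u x then 2 else 0 with hc₀
  have hg : ∀ k, ContDiff ℝ (⊤ : ℕ∞) fun x => T k (w k x) := fun k => (hTs k).comp (hw k)
  have hgd : ∀ k x, fderiv ℝ (fun x => T k (w k x)) x = deriv (T k) (w k x) • fderiv ℝ (w k) x :=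
    fun k x => ((hTd k (w k x)).hasDerivAt.comp_hasFDerivAt x
      ((hw k).differentiable (by simp) x).hasFDerivAt).fderiv
  have hclim : ∀ᵐ x ∂(volume.restrict (ball z t)),
      Tendsto (fun k => deriv (T k) (w k x)) atTop (𝓝 (c₀ x)) := by
    filter_upwards [hlim, ha, hb] with x hx hxa hxb
    exact hTlim _ _ hxa hxb hx
  have hcm : ∀ k, Continuous fun x => deriv (T k) (w k x) := fun k =>
    ((hTs k).continuous_deriv (by simp)).comp (hw k).continuous
  have hTwD : Tendsto (fun k => ∫⁻ x in ball z t,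
      ‖fderiv ℝ (fun x => T k (w k x)) x - c₀ x • Du x‖ₑ) atTop (𝓝 0) := by
    simp only [hgd]
    refine tendsto_lintegral_smul_sub_smul (M := max M 2)
      (fun k => (hcm k).aestronglyMeasurable) (fun k x => (hTM k _).trans (le_max_left _ _))
      (fun x => ?_) hclim hDu hwD
    refine le_trans ?_ (le_max_right _ _)
    simp only [hc₀]
    split_ifs <;> norm_num
  have hc₀m : AEStronglyMeasurable c₀ (volume.restrict (ball z t)) :=
    aestronglyMeasurable_of_tendsto_ae _ (fun k => (hcm k).aestronglyMeasurable) hclim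
  have hvint : IntegrableOn (fun x => |b - u x| - |u x - a| + 2 * u x - a - b) (ball z t) := by
    have h1 : IntegrableOn (fun x => b - u x) (ball z t) := (integrable_const b).sub hu
    have h2 : IntegrableOn (fun x => u x - a) (ball z t) := hu.sub (integrable_const a)
    exact ((((h1.abs.sub h2.abs).add (hu.const_mul 2)).sub (integrable_const a)).sub
      (integrable_const b))
  have hVint : IntegrableOn (fun x => c₀ x • Du x) (ball z t) := by
    refine hDu.bdd_smul 2 hc₀m (Eventually.of_forall fun x => ?_)
    simp only [hc₀]
    split_ifs <;> norm_num
  refine ⟨fun x => c₀ x • Du x, hasWeakFDeriv_of_tendsto hvint hVint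
    (fun k => (hg k).of_le (by exact_mod_cast le_top)) hTwu hTwD, hvint, hVint, fun ε hε => ?_⟩
  have hev1 := (ENNReal.tendsto_nhds_zero.1 hTwu) (ENNReal.ofReal (ε / 3)) (by simpa using hε)
  have hev2 := (ENNReal.tendsto_nhds_zero.1 hTwD) (ENNReal.ofReal (ε / 3)) (by simpa using hε)
  -- The sphere condition holds for infinitely many `k` and the approximation bounds for all large
  -- `k`, so some `k` has both. For it, T_k ∘ w_k vanishes on the open set where w_k lies in (a, b),
  -- a neighbourhood of the sphere, and its cut-off is a test function.
  obtain ⟨k, hk, hk1, hk2⟩ := (hsphere.and_eventually (hev1.and hev2)).exists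
  refine ⟨_, isTestFunction_indicator_ball (hg k) ((hw k).continuous.isOpen_preimage _ isOpen_Ioo)
    (fun x hx => hk x hx) (fun x hx => hT0 k _ (Ioo_subset_Icc_self hx)), ?_⟩
  have e1 : ∫ x in ball z t, |(|b - u x| - |u x - a| + 2 * u x - a - b) -
      (ball z t).indicator (fun x => T k (w k x)) x| ≤ ε / 3 := by
    have e : ∫ x in ball z t, |(|b - u x| - |u x - a| + 2 * u x - a - b) -
        (ball z t).indicator (fun x => T k (w k x)) x| = ∫ x in ball z t,
          ‖T k (w k x) - (|b - u x| - |u x - a| + 2 * u x - a - b)‖ := by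
      refine setIntegral_congr_fun measurableSet_ball fun x hx => ?_
      simp only [indicator_of_mem hx]
      rw [Real.norm_eq_abs, abs_sub_comm]
    have hm : AEStronglyMeasurable (fun x => T k (w k x) -
        (|b - u x| - |u x - a| + 2 * u x - a - b)) (volume.restrict (ball z t)) :=
      (hg k).continuous.aestronglyMeasurable.sub hvint.1
    rw [e, integral_norm_eq_lintegral_enorm hm]
    exact ENNReal.toReal_le_of_le_ofReal (by positivity) hk1
  have e2 : ∫ x in ball z t, ‖c₀ x • Du x -
      fderiv ℝ ((ball z t).indicator (fun x => T k (w k x))) x‖ ≤ ε / 3 := by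
    have e : ∫ x in ball z t, ‖c₀ x • Du x -
        fderiv ℝ ((ball z t).indicator (fun x => T k (w k x))) x‖ = ∫ x in ball z t,
          ‖fderiv ℝ (fun x => T k (w k x)) x - c₀ x • Du x‖ := by
      refine setIntegral_congr_fun measurableSet_ball fun x hx => ?_
      have : (ball z t).indicator (fun x => T k (w k x)) =ᶠ[𝓝 x] fun x => T k (w k x) := by
        filter_upwards [isOpen_ball.mem_nhds hx] with y hy
        exact indicator_of_mem hy _
      simp only [this.fderiv_eq]
      rw [norm_sub_rev]
    have hm : AEStronglyMeasurable (fun x => fderiv ℝ (fun x => T k (w k x)) x - c₀ x • Du x)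
        (volume.restrict (ball z t)) :=
      ((hg k).continuous_fderiv (by simp)).aestronglyMeasurable.sub hVint.1
    rw [e, integral_norm_eq_lintegral_enorm hm]
    exact ENNReal.toReal_le_of_le_ofReal (by positivity) hk2
  linarith

/-! ### Spheres of small oscillation -/

section Polar

variable {E : Type*} [NormedAddCommGroup E] [InnerProductSpace ℝ E] [FiniteDimensional ℝ E]
  [MeasurableSpace E] [BorelSpace E]

theorem setLIntegral_ball_eq_lintegral_toSphere [Nontrivial E] {F : E → ℝ≥0∞} (hF : Measurable F)
    (z : E) (R : ℝ) :
    ∫⁻ x in ball z R, F x = ∫⁻ t in Ioo 0 R, ENNReal.ofReal (t ^ (Module.finrank ℝ E - 1)) *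
      ∫⁻ θ : sphere (0 : E) 1, F (z + t • (θ : E)) ∂(volume : Measure E).toSphere := by
  have hFi : Measurable ((ball z R).indicator F) := hF.indicator measurableSet_ball
  have hFz : Measurable fun x => (ball z R).indicator F (z + x) := hFi.comp (by fun_prop)
  have hmeas : Measurable fun q : (sphere (0 : E) 1) × ℝ =>
      ENNReal.ofReal (q.2 ^ (Module.finrank ℝ E - 1)) *
        (ball z R).indicator F (z + q.2 • (q.1 : E)) :=
    (by fun_prop : Measurable fun q : (sphere (0 : E) 1) × ℝ =>
      ENNReal.ofReal (q.2 ^ (Module.finrank ℝ E - 1))).mul (hFi.comp (by fun_prop))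
  rw [← lintegral_indicator measurableSet_ball, ← lintegral_add_left_eq_self _ z,
    lintegral_eq_lintegral_toSphere hFz,
    lintegral_lintegral_swap hmeas.aemeasurable, ← lintegral_indicator measurableSet_Ioo,
    ← lintegral_indicator measurableSet_Ioi]
  refine lintegral_congr fun t => ?_
  by_cases ht : 0 < t
  · have hmem : ∀ θ : sphere (0 : E) 1, z + t • (θ : E) ∈ ball z R ↔ t < R := fun θ => by
      simp [norm_smul, abs_of_pos ht]
    have hmF : Measurable fun θ : sphere (0 : E) 1 => F (z + t • (θ : E)) :=
      hF.comp (by fun_prop)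
    rw [indicator_of_mem (mem_Ioi.2 ht)]
    by_cases htR : t < R
    · rw [indicator_of_mem (show t ∈ Ioo 0 R from ⟨ht, htR⟩), ← lintegral_const_mul _ hmF]
      refine lintegral_congr fun θ => ?_
      rw [indicator_of_mem ((hmem θ).2 htR)]
    · rw [indicator_of_notMem (show t ∉ Ioo 0 R from fun h => htR h.2)]
      simp [hmem, htR]
  · rw [indicator_of_notMem (show t ∉ Ioi 0 from ht),
      indicator_of_notMem (show t ∉ Ioo 0 R from fun h => ht h.1)]

/-- A property that holds almost everywhere on a ball holds almost everywhere on almost every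
concentric sphere. -/
theorem ae_ae_toSphere_of_ae_ball [Nontrivial E] {P : E → Prop} {z : E} {R : ℝ}
    (h : ∀ᵐ x ∂(volume.restrict (ball z R)), P x) :
    ∀ᵐ t ∂((volume : Measure ℝ).restrict (Ioo 0 R)),
      ∀ᵐ θ : sphere (0 : E) 1 ∂(volume : Measure E).toSphere, P (z + t • (θ : E)) := by
  set N := toMeasurable (volume.restrict (ball z R)) {x | ¬ P x} with hN
  have hNm : MeasurableSet N := measurableSet_toMeasurable _ _
  have hN0 : volume.restrict (ball z R) N = 0 := by rw [hN, measure_toMeasurable]; exact h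
  have hF : Measurable (N.indicator (1 : E → ℝ≥0∞)) := measurable_one.indicator hNm
  have hp := setLIntegral_ball_eq_lintegral_toSphere hF z R
  rw [lintegral_indicator_one hNm, hN0] at hp
  have hin : Measurable fun t : ℝ => ∫⁻ θ : sphere (0 : E) 1,
      N.indicator (1 : E → ℝ≥0∞) (z + t • (θ : E)) ∂(volume : Measure E).toSphere :=
    Measurable.lintegral_prod_right' (f := fun q : ℝ × (sphere (0 : E) 1) =>
      N.indicator (1 : E → ℝ≥0∞) (z + q.1 • (q.2 : E))) (hF.comp (by fun_prop))
  have hz := (lintegral_eq_zero_iff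
    ((by fun_prop : Measurable fun t : ℝ =>
      ENNReal.ofReal (t ^ (Module.finrank ℝ E - 1))).mul hin)).1 hp.symm
  filter_upwards [hz, ae_restrict_mem measurableSet_Ioo] with t ht htR
  have ht0 : ENNReal.ofReal (t ^ (Module.finrank ℝ E - 1)) ≠ 0 := by
    have := htR.1
    simp only [ne_eq, ENNReal.ofReal_eq_zero, not_le]
    positivity
  have h1 := (mul_eq_zero.1 ht).resolve_left ht0
  have hFt : Measurable fun θ : sphere (0 : E) 1 =>
      N.indicator (1 : E → ℝ≥0∞) (z + t • (θ : E)) := hF.comp (by fun_prop)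
  filter_upwards [(lintegral_eq_zero_iff hFt).1 h1] with θ hθ
  by_contra hP
  have hmem : z + t • (θ : E) ∈ N := subset_toMeasurable _ _ hP
  simp [hmem] at hθ

/-- Morrey's inequality on a sphere of radius `t`. -/
theorem exists_enorm_sub_rpow_le_lintegral_sphere_radius (hd : 2 ≤ Module.finrank ℝ E) :
    ∃ C : ℝ, 0 < C ∧ ∀ v : E → ℝ, ContDiff ℝ 1 v → ∀ p : ℝ,
      (Module.finrank ℝ E : ℝ) - 1 / 2 ≤ p → p ≤ Module.finrank ℝ E →
      ∀ (z : E) (t : ℝ), 0 < t → ∀ x ∈ sphere z t, ∀ y ∈ sphere z t,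
      ‖v x - v y‖ₑ ^ p ≤ ENNReal.ofReal C * (ENNReal.ofReal (t ^ p) *
        ∫⁻ θ : sphere (0 : E) 1, ‖fderiv ℝ v (z + t • (θ : E))‖ₑ ^ p
          ∂(volume : Measure E).toSphere) := by
  obtain ⟨C, hC, hmain⟩ := exists_enorm_sub_rpow_le_lintegral_sphere hd
  refine ⟨C, hC, fun v hv p hp hpd z t ht x hx y hy => ?_⟩
  have hd2 : (2 : ℝ) ≤ Module.finrank ℝ E := by exact_mod_cast hd
  have hp0 : 0 < p := by linarith
  have hcoord : ∀ x ∈ sphere z t, ‖t⁻¹ • (x - z)‖ = 1 ∧ z + t • (t⁻¹ • (x - z)) = x := by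
    intro x hx
    rw [mem_sphere, dist_eq_norm] at hx
    refine ⟨?_, ?_⟩
    · rw [norm_smul, hx, Real.norm_of_nonneg (by positivity), inv_mul_cancel₀ ht.ne']
    · rw [smul_smul, mul_inv_cancel₀ ht.ne', one_smul, add_sub_cancel]
  have hv' : ContDiff ℝ 1 fun ξ => v (z + t • ξ) :=
    hv.comp (contDiff_const.add (contDiff_const.smul contDiff_id))
  have h := hmain _ hv' p hp hpd _ _ (hcoord x hx).1 (hcoord y hy).1
  simp only [(hcoord x hx).2, (hcoord y hy).2] at h
  refine h.trans (le_of_eq ?_)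
  congr 1
  rw [← lintegral_const_mul' _ _ ENNReal.ofReal_ne_top]
  refine lintegral_congr fun θ => ?_
  have hfd : fderiv ℝ (fun ξ => v (z + t • ξ)) θ = t • fderiv ℝ v (z + t • (θ : E)) := by
    have h1 : HasFDerivAt (fun ξ : E => z + t • ξ) (t • ContinuousLinearMap.id ℝ E) (θ : E) :=
      ((hasFDerivAt_id (θ : E)).const_smul t).const_add z
    have h2 := ((hv.differentiable one_ne_zero) (z + t • (θ : E))).hasFDerivAt.comp (θ : E) h1
    refine h2.fderiv.trans ?_
    ext e
    simp
  rw [hfd, enorm_smul, ENNReal.mul_rpow_of_nonneg _ _ hp0.le, Real.enorm_of_nonneg ht.le,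
    ENNReal.ofReal_rpow_of_pos ht]

theorem setLIntegral_Ioo_const_mul_rpow {m R s : ℝ} (hm : 0 ≤ m) (hR : 0 ≤ R) (hs : -1 < s) :
    ∫⁻ t in Ioo 0 R, ENNReal.ofReal (m * t ^ s) = ENNReal.ofReal (m * R ^ (s + 1) / (s + 1)) := by
  have hii := (intervalIntegral.intervalIntegrable_rpow' (a := 0) (b := R) hs).const_mul m
  have hio : IntegrableOn (fun t => m * t ^ s) (Ioo 0 R) :=
    ((intervalIntegrable_iff_integrableOn_Ioc_of_le hR).1 hii).mono_set Ioo_subset_Ioc_self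
  rw [← ofReal_integral_eq_lintegral_ofReal hio, ← integral_Ioc_eq_integral_Ioo,
    ← intervalIntegral.integral_of_le hR, intervalIntegral.integral_const_mul,
    integral_rpow (Or.inl hs), Real.zero_rpow (by linarith), sub_zero, mul_div_assoc]
  filter_upwards [ae_restrict_mem measurableSet_Ioo] with t ht
  exact mul_nonneg hm (Real.rpow_nonneg ht.1.le _)

/-- A sequence of smooth functions with small energy has small oscillation, for infinitely many
indices, on some common sphere. -/
theorem exists_radius_frequently_osc_le (hd : 2 ≤ Module.finrank ℝ E) :
    ∃ C : ℝ, 0 < C ∧ ∀ w : ℕ → E → ℝ, (∀ k, ContDiff ℝ 1 (w k)) → ∀ p : ℝ,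
      (Module.finrank ℝ E : ℝ) - 1 / 2 ≤ p → p < Module.finrank ℝ E →
      ∀ (z : E) (R m : ℝ), 0 < R → 0 < m → ∀ I : ℝ≥0∞,
      (∀ k, ∫⁻ x in ball z R, ‖fderiv ℝ (w k) x‖ₑ ^ p ≤ I) →
      I < ENNReal.ofReal (m * R ^ (Module.finrank ℝ E - p) / (Module.finrank ℝ E - p)) →
      ∀ P : ℝ → Prop, (∀ᵐ t ∂((volume : Measure ℝ).restrict (Ioo 0 R)), P t) →
      ∃ t ∈ Ioo 0 R, P t ∧ ∃ᶠ k in atTop, ∀ x ∈ sphere z t, ∀ y ∈ sphere z t,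
        ‖w k x - w k y‖ₑ ^ p ≤ ENNReal.ofReal (C * m) := by
  have : Nontrivial E := Module.nontrivial_of_finrank_pos (R := ℝ) (by omega)
  obtain ⟨C, hC, hmain⟩ := exists_enorm_sub_rpow_le_lintegral_sphere_radius (E := E) hd
  refine ⟨C, hC, fun w hw p hp hpd z R m hR hm I hI hIlt P hP => ?_⟩
  set d := Module.finrank ℝ E with hdd
  by_contra! hcon
  have hG : ∀ k, Measurable fun x => ‖fderiv ℝ (w k) x‖ₑ ^ p := fun k =>
    ((hw k).continuous_fderiv one_ne_zero).enorm.measurable.pow_const p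
  set A : ℕ → ℝ → ℝ≥0∞ := fun k t => ENNReal.ofReal (t ^ (d - 1)) *
    ∫⁻ θ : sphere (0 : E) 1, ‖fderiv ℝ (w k) (z + t • (θ : E))‖ₑ ^ p
      ∂(volume : Measure E).toSphere with hA
  have hAm : ∀ k, Measurable (A k) := fun k =>
    (by fun_prop : Measurable fun t : ℝ => ENNReal.ofReal (t ^ (d - 1))).mul
      (Measurable.lintegral_prod_right' (f := fun q : ℝ × (sphere (0 : E) 1) =>
        ‖fderiv ℝ (w k) (z + q.1 • (q.2 : E))‖ₑ ^ p) ((hG k).comp (by fun_prop)))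
  -- If the claim fails, then at almost every radius the oscillation is large for all large `k`, and
  -- Morrey's inequality bounds the spherical energy below by m t^(d-1-p). Its integral over (0, R)
  -- is m R^(d-p)/(d-p), so Fatou's lemma contradicts the bound on `I`.
  have hpt : ∀ᵐ t ∂((volume : Measure ℝ).restrict (Ioo 0 R)),
      ENNReal.ofReal (m * t ^ ((d : ℝ) - 1 - p)) ≤ liminf (fun k => A k t) atTop := by
    filter_upwards [hP, ae_restrict_mem measurableSet_Ioo] with t htP ht
    refine le_liminf_of_le (by isBoundedDefault) ?_
    filter_upwards [hcon t ht htP] with k hk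
    obtain ⟨x, hx, y, hy, hxy⟩ := hk
    have h1 := hxy.le.trans (hmain (w k) (hw k) p hp hpd.le z t ht.1 x hx y hy)
    rw [ENNReal.ofReal_mul hC.le, ENNReal.mul_le_mul_iff_right
      (by simpa using hC) ENNReal.ofReal_ne_top] at h1
    have ht0 : 0 < t := ht.1
    have h2 : ENNReal.ofReal (m * t ^ ((d : ℝ) - 1 - p)) =
        ENNReal.ofReal (t ^ ((d : ℝ) - 1 - p)) * ENNReal.ofReal m := by
      rw [← ENNReal.ofReal_mul (by positivity), mul_comm]
    rw [h2]
    calc ENNReal.ofReal (t ^ ((d : ℝ) - 1 - p)) * ENNReal.ofReal m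
        ≤ ENNReal.ofReal (t ^ ((d : ℝ) - 1 - p)) * (ENNReal.ofReal (t ^ p) *
          ∫⁻ θ : sphere (0 : E) 1, ‖fderiv ℝ (w k) (z + t • (θ : E))‖ₑ ^ p
            ∂(volume : Measure E).toSphere) := by gcongr
      _ = A k t := by
          have hexp : (d : ℝ) - 1 - p + p = ((d - 1 : ℕ) : ℝ) := by
            rw [Nat.cast_sub (by omega)]
            push_cast
            ring
          rw [← mul_assoc, ← ENNReal.ofReal_mul (by positivity), ← Real.rpow_add ht0, hexp,
            Real.rpow_natCast]
  have hfinal : ENNReal.ofReal (m * R ^ (d - p) / (d - p)) ≤ I := by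
    calc ENNReal.ofReal (m * R ^ (d - p) / (d - p))
        = ∫⁻ t in Ioo 0 R, ENNReal.ofReal (m * t ^ ((d : ℝ) - 1 - p)) := by
          rw [setLIntegral_Ioo_const_mul_rpow hm.le hR.le (by linarith)]
          congr 2 <;> ring_nf
      _ ≤ ∫⁻ t in Ioo 0 R, liminf (fun k => A k t) atTop := lintegral_mono_ae hpt
      _ ≤ liminf (fun k => ∫⁻ t in Ioo 0 R, A k t) atTop := lintegral_liminf_le hAm
      _ ≤ I := by
          refine liminf_le_of_frequently_le' (Frequently.of_forall fun k => ?_)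
          rw [← setLIntegral_ball_eq_lintegral_toSphere (hG k)]
          exact hI k
  exact absurd hIlt (not_lt.2 hfinal)

end Polar

/-! ### Oscillation of weakly monotone functions -/

/-- Only countably many level sets have positive measure, and a countable set of levels has dense
complement. -/
theorem exists_mem_Ioo_ae_ne {α : Type*} [MeasurableSpace α] {μ : Measure α} [SFinite μ]
    {u : α → ℝ} (hu : AEMeasurable u μ) {c d : ℝ} (hcd : c < d) :
    ∃ a ∈ Ioo c d, ∀ᵐ x ∂μ, u x ≠ a := by
  have hcount := Measure.countable_meas_level_set_pos₀ hu.nullMeasurable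
  obtain ⟨a, ha, hac⟩ := (hcount.dense_compl ℝ).exists_between hcd
  refine ⟨a, hac, ?_⟩
  have h0 : μ {x | u x = a} = 0 := by simpa using ha
  rw [ae_iff]
  simpa using h0

/-- Weakly monotone functions with `ε ∫ ‖Du‖ ^ (n - ε) → 0` have vanishing essential oscillation at
every point, in dimension at least two. -/
theorem exists_ae_norm_sub_le_of_weaklyMonotone {n : ℕ} (hn : 2 ≤ n)
    {Ω : Set (EuclideanSpace ℝ (Fin n))} (hΩ : IsOpen Ω) {u : EuclideanSpace ℝ (Fin n) → ℝ}
    {Du : EuclideanSpace ℝ (Fin n) → EuclideanSpace ℝ (Fin n) →L[ℝ] ℝ}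
    (hu : HasWeakFDeriv Ω u Du) (hmono : WeaklyMonotone Ω u)
    {z : EuclideanSpace ℝ (Fin n)} {R' : ℝ} (hR' : 0 < R') (hz : closedBall z R' ⊆ Ω)
    (hen : Tendsto (fun ε : ℝ => ∫⁻ x in ball z R', ENNReal.ofReal (ε * ‖Du x‖ ^ ((n : ℝ) - ε)))
      (𝓝[>] 0) (𝓝 0)) {δ : ℝ} (hδ : 0 < δ) :
    ∃ t : ℝ, 0 < t ∧ ∃ c : ℝ, ∀ᵐ x ∂(volume.restrict (ball z t)), ‖u x - c‖ ≤ δ := by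
  have hfr : Module.finrank ℝ (EuclideanSpace ℝ (Fin n)) = n := by simp
  have : Nontrivial (EuclideanSpace ℝ (Fin n)) :=
    Module.nontrivial_of_finrank_pos (R := ℝ) (by omega)
  obtain ⟨C, hC, hosc⟩ := exists_radius_frequently_osc_le (E := EuclideanSpace ℝ (Fin n))
    (by omega)
  rw [hfr] at hosc
  set R := R' / 2 with hRdef
  have hR : 0 < R := by positivity
  have hRR' : R < R' := by rw [hRdef]; linarith
  -- The levels will lie within 3η of the centre value, hence η ≤ δ/3; η ≤ 1 ensures η^n ≤ η^p, so
  -- that C m = η^n below yields oscillation at most η.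
  set η := min (δ / 3) 1 with hη
  have hη0 : 0 < η := by positivity
  have hη1 : η ≤ 1 := min_le_right _ _
  have hηδ : 3 * η ≤ δ := by linarith [min_le_left (δ / 3) 1]
  set m := η ^ n / C with hm
  have hm0 : 0 < m := by positivity
  obtain ⟨w, hws, hwlim, hwu, hwD, hwI⟩ := hu.exists_smooth_approx hΩ hRR' hz
  have hRε : ∀ᶠ ε : ℝ in 𝓝[>] 0, 1 / 2 < R ^ ε := by
    have h1 : Tendsto (fun ε : ℝ => R ^ ε) (𝓝[>] 0) (𝓝 1) := by
      have := (Real.continuousAt_const_rpow hR.ne' (b := 0)).tendsto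
      rw [Real.rpow_zero] at this
      exact this.mono_left nhdsWithin_le_nhds
    exact h1.eventually_const_lt (by norm_num)
  have hsmall : ∀ᶠ ε : ℝ in 𝓝[>] 0, ∫⁻ x in ball z R',
      ENNReal.ofReal (ε * ‖Du x‖ ^ ((n : ℝ) - ε)) < ENNReal.ofReal (m / 2) :=
    hen.eventually_lt_const (by simpa using hm0)
  have hlt : ∀ᶠ ε : ℝ in 𝓝[>] 0, ε ∈ Ioo (0 : ℝ) (1 / 2) := Ioo_mem_nhdsGT (by norm_num)
  -- Since ε I < m/2 and R^ε > 1/2, one gets I < m R^ε / ε; ε < 1/2 keeps the exponent in the range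
  -- where the Morrey constant is uniform.
  obtain ⟨ε, hε1, hε2, hε0, hε⟩ := (hRε.and (hsmall.and hlt)).exists
  set p : ℝ := n - ε with hp
  have hn2 : (2 : ℝ) ≤ n := by exact_mod_cast hn
  have hp0 : 0 < p := by linarith
  set I := ∫⁻ x in ball z R', ‖Du x‖ₑ ^ p with hI
  have hIlt : I < ENNReal.ofReal (m * R ^ ((n : ℝ) - p) / (n - p)) := by
    have h1 : ∫⁻ x in ball z R', ENNReal.ofReal (ε * ‖Du x‖ ^ p) = ENNReal.ofReal ε * I := by
      rw [hI, ← lintegral_const_mul' _ _ ENNReal.ofReal_ne_top]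
      refine lintegral_congr fun x => ?_
      rw [ENNReal.ofReal_mul hε0.le, ← ofReal_norm,
        ENNReal.ofReal_rpow_of_nonneg (norm_nonneg _) hp0.le]
    rw [h1] at hε2
    have h2 : (n : ℝ) - p = ε := by rw [hp]; ring
    have hε0' : ENNReal.ofReal ε ≠ 0 := by simpa using hε0
    rw [h2, ENNReal.ofReal_div_of_pos hε0, ENNReal.lt_div_iff_mul_lt (Or.inl hε0')
      (Or.inl ENNReal.ofReal_ne_top), mul_comm]
    refine hε2.trans_le (ENNReal.ofReal_le_ofReal ?_)
    nlinarith
  obtain ⟨t, ht, htP, hfreq⟩ := hosc w (fun k => (hws k).of_le (by exact_mod_cast le_top)) p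
    (by linarith) (by linarith) z R m hR hm0 I (fun k => hwI p (by linarith) k) hIlt _
    (ae_ae_toSphere_of_ae_ball hwlim)
  have hσ : NeBot (ae (volume : Measure (EuclideanSpace ℝ (Fin n))).toSphere) :=
    ae_neBot.2 (Measure.toSphere_ne_zero _)
  obtain ⟨θ, hθ⟩ := htP.exists
  have ht0 : 0 < t := ht.1
  -- The centre value is taken at a point of the sphere where w_k converges to `u`, which exists
  -- because almost every sphere has convergence almost everywhere.
  set c := u (z + t • (θ : EuclideanSpace ℝ (Fin n))) with hc
  have hθs : z + t • (θ : EuclideanSpace ℝ (Fin n)) ∈ sphere z t := by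
    simp [norm_smul, abs_of_pos ht0]
  have hfreq2 : ∃ᶠ k in atTop, ∀ x ∈ sphere z t, |w k x - c| < 2 * η := by
    have hev : ∀ᶠ k in atTop, |w k (z + t • (θ : EuclideanSpace ℝ (Fin n))) - c| < η := by
      simpa [Real.dist_eq] using hθ.eventually (ball_mem_nhds c hη0)
    refine (hfreq.and_eventually hev).mono fun k hk x hx => ?_
    have h1 := hk.1 x hx _ hθs
    have h2 : ENNReal.ofReal (C * m) ≤ ENNReal.ofReal η ^ p := by
      rw [ENNReal.ofReal_rpow_of_nonneg hη0.le hp0.le]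
      refine ENNReal.ofReal_le_ofReal ?_
      rw [hm, mul_div_cancel₀ _ hC.ne', ← Real.rpow_natCast]
      exact Real.rpow_le_rpow_of_exponent_ge hη0 hη1 (by linarith)
    have h3 := (ENNReal.rpow_le_rpow_iff hp0).1 (h1.trans h2)
    rw [← ofReal_norm, ENNReal.ofReal_le_ofReal_iff hη0.le, Real.norm_eq_abs] at h3
    have h4 := abs_sub_le (w k x) (w k (z + t • (θ : EuclideanSpace ℝ (Fin n)))) c
    linarith [hk.2]
  have htR : t < R := ht.2
  have hsub : ball z t ⊆ ball z R := ball_subset_ball htR.le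
  have hcl : closedBall z t ⊆ Ω := (closedBall_subset_closedBall (by linarith)).trans hz
  have huB : IntegrableOn u (ball z t) := (hu.locallyIntegrable.integrableOn_compact_subset hcl
    (isCompact_closedBall z t)).mono_set ball_subset_closedBall
  have hDuB : IntegrableOn Du (ball z t) :=
    (hu.locallyIntegrable_deriv.integrableOn_compact_subset hcl
      (isCompact_closedBall z t)).mono_set ball_subset_closedBall
  have hres : volume.restrict (ball z t) ≤ volume.restrict (ball z R) :=
    Measure.restrict_mono hsub le_rfl
  -- On the sphere w_k is within 2η of `c`; the room between 2η and 3η allows levels that `u` avoids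
  -- almost everywhere.
  obtain ⟨a, ha, hane⟩ := exists_mem_Ioo_ae_ne huB.1.aemeasurable
    (by linarith : c - 3 * η < c - 2 * η)
  obtain ⟨b, hb, hbne⟩ := exists_mem_Ioo_ae_ne huB.1.aemeasurable
    (by linarith : c + 2 * η < c + 3 * η)
  have hab : a ≤ b := by linarith [ha.2, hb.1]
  have hW := memW11Zero_truncation huB hDuB hws (ae_mono hres hwlim)
    (tendsto_of_tendsto_of_tendsto_of_le_of_le tendsto_const_nhds hwu (fun _ => zero_le)
      fun k => lintegral_mono' hres le_rfl)
    (tendsto_of_tendsto_of_tendsto_of_le_of_le tendsto_const_nhds hwD (fun _ => zero_le)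
      fun k => lintegral_mono' hres le_rfl) hab hane hbne
    (hfreq2.mono fun k hk x hx => by
      have := abs_lt.1 (hk x hx)
      exact ⟨by linarith [ha.2], by linarith [hb.1]⟩)
  refine ⟨t, ht0, c, ?_⟩
  filter_upwards [hmono.2 z t ht0 hcl a b hab hW] with x hx
  rw [Real.norm_eq_abs, abs_le]
  exact ⟨by linarith [ha.1, hx.1], by linarith [hb.2, hx.2]⟩

/-! ### Dimension one -/

/-- On an interval the oscillation of a function is bounded by the integral of its derivative. -/
theorem enorm_sub_le_setLIntegral_ball {v : EuclideanSpace ℝ (Fin 1) → ℝ} (hv : ContDiff ℝ 1 v)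
    {z x y : EuclideanSpace ℝ (Fin 1)} {R : ℝ} (hx : x ∈ ball z R) (hy : y ∈ ball z R) :
    ‖v x - v y‖ₑ ≤ ∫⁻ ξ in ball z R, ‖fderiv ℝ v ξ‖ₑ := by
  set L : ℝ ≃ₗᵢ[ℝ] EuclideanSpace ℝ (Fin 1) := (OrthonormalBasis.singleton (Fin 1) ℝ).repr
  obtain ⟨ξ, rfl⟩ := L.surjective x
  obtain ⟨η, rfl⟩ := L.surjective y
  have hG : Measurable fun x => ‖fderiv ℝ v x‖ₑ :=
    (hv.continuous_fderiv one_ne_zero).enorm.measurable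
  have hder : ∀ τ, HasDerivAt (fun τ => v (L τ)) (fderiv ℝ v (L τ) (L 1)) τ := fun τ => by
    have h1 : HasDerivAt (fun τ => L τ) (L 1) τ :=
      L.toContinuousLinearEquiv.toContinuousLinearMap.hasDerivAt
    exact ((hv.differentiable one_ne_zero) (L τ)).hasFDerivAt.comp_hasDerivAt τ h1
  have hcont : Continuous fun τ => fderiv ℝ v (L τ) (L 1) :=
    ((hv.continuous_fderiv one_ne_zero).comp L.continuous).clm_apply continuous_const
  have hFTC := intervalIntegral.integral_eq_sub_of_hasDerivAt (fun τ _ => hder τ)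
    (hcont.intervalIntegrable η ξ)
  have hsub : uIoc η ξ ⊆ L ⁻¹' ball z R := by
    refine uIoc_subset_uIcc.trans ?_
    rw [← segment_eq_uIcc]
    exact ((convex_ball z R).is_linear_preimage L.toLinearEquiv.toLinearMap.isLinear).segment_subset
      hy hx
  rw [← hFTC, ← ofReal_norm, intervalIntegral.norm_intervalIntegral_eq, ofReal_norm]
  calc ‖∫ τ in uIoc η ξ, fderiv ℝ v (L τ) (L 1)‖ₑ
      ≤ ∫⁻ τ in uIoc η ξ, ‖fderiv ℝ v (L τ) (L 1)‖ₑ := enorm_integral_le_lintegral_enorm _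
    _ ≤ ∫⁻ τ in uIoc η ξ, ‖fderiv ℝ v (L τ)‖ₑ := by
        refine lintegral_mono fun τ => (ContinuousLinearMap.le_opENorm _ _).trans (le_of_eq ?_)
        rw [← ofReal_norm (L 1), L.norm_map]
        simp
    _ ≤ ∫⁻ τ in L ⁻¹' ball z R, ‖fderiv ℝ v (L τ)‖ₑ := lintegral_mono_set hsub
    _ = ∫⁻ ξ in ball z R, ‖fderiv ℝ v ξ‖ₑ :=
        L.measurePreserving.setLIntegral_comp_preimage measurableSet_ball hG

/-- Sobolev functions of one variable have vanishing essential oscillation at every point. -/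
theorem exists_ae_norm_sub_le_of_dim_one {Ω : Set (EuclideanSpace ℝ (Fin 1))} (hΩ : IsOpen Ω)
    {u : EuclideanSpace ℝ (Fin 1) → ℝ}
    {Du : EuclideanSpace ℝ (Fin 1) → EuclideanSpace ℝ (Fin 1) →L[ℝ] ℝ}
    (hu : HasWeakFDeriv Ω u Du) {z : EuclideanSpace ℝ (Fin 1)} {R₀ : ℝ} (hR₀ : 0 < R₀)
    (hz : closedBall z R₀ ⊆ Ω) {δ : ℝ} (hδ : 0 < δ) :
    ∃ t : ℝ, 0 < t ∧ ∃ c : ℝ, ∀ᵐ x ∂(volume.restrict (ball z t)), ‖u x - c‖ ≤ δ := by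
  have hDu : IntegrableOn Du (closedBall z R₀) :=
    hu.locallyIntegrable_deriv.integrableOn_compact_subset hz (isCompact_closedBall z R₀)
  -- Absolute continuity of the integral: on a short enough interval ∫ ‖Du‖ is below δ, which bounds
  -- the oscillation of every mollification and passes to the limit.
  obtain ⟨τ, hτ, hτs⟩ := exists_pos_setLIntegral_lt_of_measure_lt hDu.2.ne
    (ε := ENNReal.ofReal δ) (by simpa using hδ)
  have hvol : Tendsto (fun r => volume (closedBall z r)) (𝓝[>] 0) (𝓝 0) := by
    have := tendsto_measure_biInter_gt (μ := (volume : Measure (EuclideanSpace ℝ (Fin 1))))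
      (s := fun r : ℝ => closedBall z r) (a := 0)
      (fun r _ => measurableSet_closedBall.nullMeasurableSet)
      (fun i j _ hij => closedBall_subset_closedBall hij) ⟨1, one_pos, measure_closedBall_lt_top.ne⟩
    have h0 : (⋂ r > (0 : ℝ), closedBall z r) = {z} := by
      ext x
      simp only [mem_iInter, mem_closedBall, mem_singleton_iff]
      refine ⟨fun h => dist_le_zero.1 (le_of_forall_gt_imp_ge_of_dense h), ?_⟩
      rintro rfl r hr
      simpa using le_of_lt hr
    rwa [h0, measure_singleton] at this
  obtain ⟨R', hR'τ, hR'0, hR'R₀⟩ := ((hvol.eventually_lt_const hτ).and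
    (Ioo_mem_nhdsGT hR₀)).exists
  set R := R' / 2 with hR
  have hRR' : R < R' := by rw [hR]; linarith
  have hR0 : 0 < R := by rw [hR]; linarith
  obtain ⟨w, hws, hwlim, -, -, hwI⟩ := hu.exists_smooth_approx hΩ hRR'
    ((closedBall_subset_closedBall hR'R₀.le).trans hz)
  have hosc : ∀ k, ∀ x ∈ ball z R, ∀ y ∈ ball z R, |w k x - w k y| ≤ δ := by
    intro k x hx y hy
    have h1 := enorm_sub_le_setLIntegral_ball ((hws k).of_le (by exact_mod_cast le_top)) hx hy
    have h2 := hwI 1 le_rfl k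
    simp only [ENNReal.rpow_one] at h2
    have h3 : ∫⁻ x in ball z R', ‖Du x‖ₑ ≤ ENNReal.ofReal δ := by
      have h4 := hτs (ball z R') ((Measure.restrict_apply_le _ _).trans_lt
        ((measure_mono ball_subset_closedBall).trans_lt hR'τ))
      rw [Measure.restrict_restrict measurableSet_ball, inter_eq_left.2
        (ball_subset_closedBall.trans (closedBall_subset_closedBall hR'R₀.le))] at h4
      exact h4.le
    have h5 := h1.trans (h2.trans h3)
    rwa [← ofReal_norm, ENNReal.ofReal_le_ofReal_iff hδ.le, Real.norm_eq_abs] at h5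
  have hne : NeBot (ae (volume.restrict (ball z R))) := by
    rw [ae_neBot, ne_eq, Measure.restrict_eq_zero]
    exact (measure_ball_pos _ _ hR0).ne'
  obtain ⟨y, hylim, hy⟩ := (hwlim.and (ae_restrict_mem measurableSet_ball)).exists
  refine ⟨R, hR0, u y, ?_⟩
  filter_upwards [hwlim, ae_restrict_mem measurableSet_ball] with x hxlim hx
  exact le_of_tendsto (hxlim.sub hylim).norm (Eventually.of_forall fun k => hosc k x hx y hy)

/-! ### Passage to coordinates and conclusion -/

theorem LocallyIntegrableOn.integrableOn_smul_of_tsupport_subset {X F : Type*} [TopologicalSpace X]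
    [T2Space X] [MeasurableSpace X] [OpensMeasurableSpace X] {μ : Measure X} [NormedAddCommGroup F]
    [NormedSpace ℝ F] {U : Set X} {f : X → F} (hf : LocallyIntegrableOn f U μ) {g : X → ℝ}
    (hg : Continuous g) (hgc : HasCompactSupport g) (hgU : tsupport g ⊆ U) :
    IntegrableOn (fun x => g x • f x) U μ := by
  have h1 : IntegrableOn (fun x => g x • f x) (tsupport g) μ :=
    (hf.integrableOn_compact_subset hgU hgc).continuousOn_smul hg.continuousOn hgc
  refine ((integrableOn_iff_integrable_of_support_subset fun x hx => ?_).1 h1).integrableOn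
  refine subset_tsupport g fun h0 => hx ?_
  simp [h0]

/-- Weak differentials commute with continuous linear maps. -/
theorem HasWeakFDeriv.clm_comp {n : ℕ} {F F' : Type*} [NormedAddCommGroup F] [NormedSpace ℝ F]
    [CompleteSpace F] [NormedAddCommGroup F'] [NormedSpace ℝ F'] [CompleteSpace F']
    {U : Set (EuclideanSpace ℝ (Fin n))} {f : EuclideanSpace ℝ (Fin n) → F}
    {Df : EuclideanSpace ℝ (Fin n) → EuclideanSpace ℝ (Fin n) →L[ℝ] F}
    (h : HasWeakFDeriv U f Df) (L : F →L[ℝ] F') :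
    HasWeakFDeriv U (fun x => L (f x)) (fun x => L.comp (Df x)) := by
  have hloc : LocallyIntegrableOn (fun x => L.comp (Df x)) U := fun x hx => by
    obtain ⟨s, hs, hi⟩ := h.locallyIntegrable_deriv x hx
    exact ⟨s, hs, (ContinuousLinearMap.compL ℝ (EuclideanSpace ℝ (Fin n)) F F' L).integrable_comp
      hi⟩
  refine ⟨fun x hx => ?_, hloc, fun φ hφ v => ?_⟩
  · obtain ⟨s, hs, hi⟩ := h.locallyIntegrable x hx
    exact ⟨s, hs, L.integrable_comp hi⟩
  · have hφ1 : ContDiff ℝ 1 φ := hφ.smooth.of_le (by exact_mod_cast le_top)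
    have hdv : LocallyIntegrableOn (fun x => Df x v) U := fun x hx => by
      obtain ⟨s, hs, hi⟩ := h.locallyIntegrable_deriv x hx
      exact ⟨s, hs, hi.apply_continuousLinearMap v⟩
    have hsupp : Function.support (fun x => fderiv ℝ φ x v) ⊆ Function.support (fderiv ℝ φ) :=
      fun x hx h0 => hx (by simp [h0])
    have hts : tsupport (fun x => fderiv ℝ φ x v) ⊆ tsupport φ :=
      (closure_mono hsupp).trans (tsupport_fderiv_subset ℝ (f := φ))
    have hi1 := LocallyIntegrableOn.integrableOn_smul_of_tsupport_subset h.locallyIntegrable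
      (g := fun x => fderiv ℝ φ x v)
      ((hφ1.continuous_fderiv one_ne_zero).clm_apply continuous_const)
      (hφ.compact.of_isClosed_subset (isClosed_tsupport _) hts) (hts.trans hφ.support_subset)
    have hi2 := LocallyIntegrableOn.integrableOn_smul_of_tsupport_subset hdv hφ1.continuous
      hφ.compact hφ.support_subset
    have e1 := L.integral_comp_comm hi1
    have e2 := L.integral_comp_comm hi2
    simp only [map_smul] at e1 e2
    simp only [ContinuousLinearMap.comp_apply]
    rw [e1, e2, h.integral_eq φ hφ v, map_neg]

/-- The integrability of the differential of a curve with exponentially integrable distortion. -/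
theorem tendsto_energy_of_distortion {n m : ℕ} (hn : 1 ≤ n)
    {Ω : Set (EuclideanSpace ℝ (Fin n))}
    {ω : EuclideanSpace ℝ (Fin m) → EuclideanSpace ℝ (Fin m) [⋀^Fin n]→L[ℝ] ℝ}
    (hωb : IsBoundedForm ω) {f : EuclideanSpace ℝ (Fin n) → EuclideanSpace ℝ (Fin m)}
    {Df : EuclideanSpace ℝ (Fin n) → EuclideanSpace ℝ (Fin n) →L[ℝ] EuclideanSpace ℝ (Fin m)}
    {K : EuclideanSpace ℝ (Fin n) → ℝ≥0∞} (hDf : LocallyIntegrableOn Df Ω)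
    (hJ : LocallyIntegrableOn (starPullback ω f Df) Ω) (hK1 : ∀ x ∈ Ω, 1 ≤ K x)
    (hKfin : ∀ᵐ x ∂(volume.restrict Ω), K x < ∞)
    (hdist : ∀ᵐ x ∂(volume.restrict Ω),
      comass (ω (f x)) * ‖Df x‖ ^ n ≤ (K x).toReal * starPullback ω f Df x)
    {lam : ℝ} (hlam : 0 < lam)
    (hexp : LocallyIntegrableOn (fun x => Real.exp (lam * (K x).toReal)) Ω)
    {z : EuclideanSpace ℝ (Fin n)} {R : ℝ} (hz : closedBall z R ⊆ Ω)
    (L : EuclideanSpace ℝ (Fin m) →L[ℝ] ℝ) (hL : ‖L‖ ≤ 1) :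
    Tendsto (fun ε : ℝ => ∫⁻ x in ball z R,
      ENNReal.ofReal (ε * ‖L.comp (Df x)‖ ^ ((n : ℝ) - ε))) (𝓝[>] 0) (𝓝 0) := by
  obtain ⟨c, hc, hlow⟩ := hωb.bounded_below
  have hBΩ : ball z R ⊆ Ω := ball_subset_closedBall.trans hz
  have hfin : IsFiniteMeasure (volume.restrict (ball z R)) :=
    ⟨by rw [Measure.restrict_apply_univ]; exact measure_ball_lt_top⟩
  have hint : ∀ {G : Type} [NormedAddCommGroup G] {g : EuclideanSpace ℝ (Fin n) → G},
      LocallyIntegrableOn g Ω → IntegrableOn g (ball z R) := fun hg =>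
    (hg.integrableOn_compact_subset hz (isCompact_closedBall z R)).mono_set ball_subset_closedBall
  have hres : volume.restrict (ball z R) ≤ volume.restrict Ω := Measure.restrict_mono hBΩ le_rfl
  have hm : AEStronglyMeasurable (fun x => L.comp (Df x)) (volume.restrict (ball z R)) :=
    ((ContinuousLinearMap.compL ℝ (EuclideanSpace ℝ (Fin n)) _ ℝ L).integrable_comp (hint hDf)).1
  refine tendsto_mul_lintegral_rpow_zero hn hm (κ := fun x => (K x).toReal) hc hlam ?_ (hint hJ)
    (hint hexp) ?_
  · filter_upwards [ae_mono hres hKfin, ae_restrict_mem measurableSet_ball] with x hx hxB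
    simpa using ENNReal.toReal_mono hx.ne (hK1 x (hBΩ hxB))
  · filter_upwards [ae_mono hres hdist] with x hx
    refine le_trans ?_ hx
    obtain ⟨I, hI⟩ := hlow (f x)
    have h1 : ‖L.comp (Df x)‖ ≤ ‖Df x‖ :=
      (L.opNorm_comp_le _).trans (mul_le_of_le_one_left (norm_nonneg _) hL)
    have h2 : c ≤ comass (ω (f x)) := hI.le.trans (abs_formCoeff_le_comass ω I (f x))
    have h3 : 0 ≤ comass (ω (f x)) := hc.le.trans h2
    gcongr

theorem theorem1p3 {n m : ℕ} (hnm : n ≤ m)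
    (Ω : Set (EuclideanSpace ℝ (Fin n))) (hΩo : IsOpen Ω) (hΩc : IsConnected Ω)
    (ω : EuclideanSpace ℝ (Fin m) → EuclideanSpace ℝ (Fin m) [⋀^Fin n]→L[ℝ] ℝ)
    (hω : IsVolumeForm ω) (hωb : IsBoundedForm ω)
    (f : EuclideanSpace ℝ (Fin n) → EuclideanSpace ℝ (Fin m))
    (K : EuclideanSpace ℝ (Fin n) → ℝ≥0∞)
    (hf : IsFiniteDistortionCurve Ω ω f K)
    (hmono : ∀ i : Fin m, WeaklyMonotone Ω (fun x => f x i))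
    (hK : ∃ lam : ℝ, 0 < lam ∧
      LocallyIntegrableOn (fun x => Real.exp (lam * (K x).toReal)) Ω) :
    ∃ g : EuclideanSpace ℝ (Fin n) → EuclideanSpace ℝ (Fin m),
      ContinuousOn g Ω ∧ g =ᵐ[volume.restrict Ω] f := by
  -- For n = 0 the space is a single point and every map is continuous.
  rcases Nat.eq_zero_or_pos n with rfl | hn
  · exact ⟨f, (continuous_of_const fun x y => by rw [Subsingleton.elim x y]).continuousOn,
      EventuallyEq.rfl⟩
  obtain ⟨Df, hDf, hJ, -, hK1, hKfin, hdist⟩ := hf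
  obtain ⟨lam, hlam, hexp⟩ := hK
  have hcomp : ∀ i : Fin m, ∃ g : EuclideanSpace ℝ (Fin n) → ℝ,
      ContinuousOn g Ω ∧ g =ᵐ[volume.restrict Ω] fun x => f x i := by
    intro i
    set L : EuclideanSpace ℝ (Fin m) →L[ℝ] ℝ := EuclideanSpace.proj i with hL
    have hL1 : ‖L‖ ≤ 1 := L.opNorm_le_bound zero_le_one fun x => by
      simpa [hL] using PiLp.norm_apply_le x i
    have hu : HasWeakFDeriv Ω (fun x => f x i) (fun x => L.comp (Df x)) := hDf.clm_comp L
    refine exists_continuousOn_ae_eq_of_essOsc hΩo _ fun z hz δ hδ => ?_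
    obtain ⟨R, hR, hRΩ⟩ := nhds_basis_closedBall.mem_iff.1 (hΩo.mem_nhds hz)
    -- For n = 1 a sphere is a pair of points and Morrey's inequality along it has no meaning, so
    -- the interval argument is used instead.
    rcases (Nat.succ_le_of_lt hn).eq_or_lt with h1 | h2
    · obtain rfl : n = 1 := h1.symm
      exact exists_ae_norm_sub_le_of_dim_one hΩo hu hR hRΩ hδ
    · exact exists_ae_norm_sub_le_of_weaklyMonotone h2 hΩo hu (hmono i) hR hRΩ
        (tendsto_energy_of_distortion hn hωb hDf.locallyIntegrable_deriv hJ hK1 hKfin hdist hlam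
          hexp hRΩ L hL1) hδ
  choose g hg hgf using hcomp
  refine ⟨fun x => WithLp.toLp 2 fun i => g i x,
    (PiLp.continuous_toLp 2 _).comp_continuousOn (continuousOn_pi.2 hg), ?_⟩
  filter_upwards [ae_all_iff.2 hgf] with x hx
  ext i
  exact hx i
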